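/- **Setting.** Let $\mathcal X$ be a set. Let $\{\zeta_i\}_{i\ge 1}$ be the points (in any enumeration) of a Poisson process on $(0,\infty)$ with intensity $\zeta^{-2}\,d\zeta$ and, independently of it, let $Y_1,Y_2,\dots$ be independent copies of a non-negative stochastic process $Y$ on $\mathcal X$ with $\mathbb E\,Y(s)=1$ for every $s\in\mathcal X$. Put $\varphi_i=\zeta_iY_i$ and $\eta(s)=\max_{i\ge1}\varphi_i(s)$. Let $X$ be a max-stable process on $\mathcal X$ with this spectral representation, that is, a real-valued process such that, for some deterministic transformations $h_s$, each strictly increasing on a Borel set in which $X(s)$ almost surely takes its values, the processes $\{h_s(X(s))\}_{s\in\mathcal X}$ and $\{\eta(s)\}_{s\in\mathcal X}$ have the same finite-dimensional distributions. (The case $X=\eta$, $h_s(x)=x$, is included.) Let $X_1,X_2,\dots$ be independent copies of $X$, let $k\ge2$ and $s_1,\dots,s_k\in\mathcal X$. Define - the sample concurrence probability, for $m\ge1$, $$p_m=\mathbb P\Big\{\text{for some } \ell\in\{1,\dots,m\}:\ \max_{1\le i\le m}X_i(s_j)=X_\ell(s_j),\ j=1,\dots,k\Big\};$$ - the extremal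 concurrence probability $$p=\mathbb P\big\{\text{for some } \ell\ge1:\ \eta(s_j)=\varphi_\ell(s_j),\ j=1,\dots,k\big\};$$ - the extremal hitting scenario $\pi$, the random partition of $\{1,\dots,k\}$ in which $j_1,j_2$ lie in the same block if and only if $\arg\max_{i\ge1}\varphi_i(s_{j_1})=\arg\max_{i\ge1}\varphi_i(s_{j_2})$, and its number of blocks $|\pi|$. **Proposition.** For every $m\ge1$, $$p_m=p+\sum_{\ell=2}^k\mathbb P(|\pi|=\ell)\,m^{1-\ell}.$$ Moreover, $p_m$ is non-increasing in $m\ge1$, and $$0\le p_m-p\le\frac{1-p}{m},\qquad m\ge1.$$ Furthermore, if $p<1$, then there exist an integer $r\in\{1,\dots,k-1\}$ and a constant $c_r\in(0,1-p]$ such that $p_m-p\sim c_r/m^r$ as $m\to\infty$. -/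

import Mathlib

open MeasureTheory ProbabilityTheory Filter Asymptotics

namespace Concurrence

noncomputable section

/-- `Z 0, Z 1, …` are independent, identically distributed real-valued stochastic processes
indexed by `S`. Laws and independence are those of random elements of `S → ℝ` with the product
(cylinder) sigma-algebra. -/
structure IsIIDCopies {S Ω : Type*} [MeasurableSpace Ω] (Z : ℕ → S → Ω → ℝ)
    (P : Measure Ω) : Prop where
  measurable : ∀ i x, Measurable (Z i x)
  indep : iIndepFun (fun i ω x => Z i x ω) P
  identDistrib : ∀ i, IdentDistrib (fun ω x => Z i x ω) (fun ω x => Z 0 x ω) P P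

/-- The number of points (with multiplicity) of the random family `ζ` that lie in `A`. -/
def pointCount {Ω : Type*} (ζ : ℕ → Ω → ℝ) (A : Set ℝ) (ω : Ω) : ℕ∞ :=
  {i : ℕ | ζ i ω ∈ A}.encard

/-- The random variables `ζ 0, ζ 1, …` enumerate (in any order) the points of a Poisson process
on the real line with intensity measure `Λ`: counts of sets of finite intensity are Poisson
distributed, and counts of pairwise disjoint sets are independent. -/
structure IsPoissonProcess {Ω : Type*} [MeasurableSpace Ω] (ζ : ℕ → Ω → ℝ) (Λ : Measure ℝ)
    (P : Measure Ω) : Prop where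
  measurable : ∀ i, Measurable (ζ i)
  map_count : ∀ A : Set ℝ, MeasurableSet A → Λ A ≠ ⊤ →
    P.map (pointCount ζ A) = (poissonMeasure (Λ A).toNNReal).map (fun n : ℕ => (n : ℕ∞))
  indep_count : ∀ (n : ℕ) (A : Fin n → Set ℝ), (∀ i, MeasurableSet (A i)) →
    Pairwise (fun i j => Disjoint (A i) (A j)) → iIndepFun (fun i => pointCount ζ (A i)) P

/-- The measure `z⁻² dz` on `(0, ∞)`, as a measure on the line which gives no mass to `(-∞, 0]`. -/
def frechetIntensity : Measure ℝ :=
  (volume.restrict (Set.Ioi (0 : ℝ))).withDensity (fun z => ENNReal.ofReal ((z ^ 2)⁻¹))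

/-- The ingredients of a spectral representation: a Poisson process `{ζ i}` on `(0, ∞)` with
intensity `z⁻² dz` and, independently of it, i.i.d. copies `Y i` of a non-negative process with
mean one at every point. -/
structure IsSpectralRepresentation {S Ω : Type*} [MeasurableSpace Ω] (ζ : ℕ → Ω → ℝ)
    (Y : ℕ → S → Ω → ℝ) (P : Measure Ω) : Prop where
  poisson : IsPoissonProcess ζ frechetIntensity P
  iid : IsIIDCopies Y P
  indep : IndepFun (fun ω i => ζ i ω) (fun ω i x => Y i x ω) P
  nonneg : ∀ i x, ∀ᵐ ω ∂P, 0 ≤ Y i x ω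
  mean_one : ∀ x, ∫ ω, Y 0 x ω ∂P = 1

/-- The atoms `φ_i = ζ_i Y_i` of the point process of functions. -/
def atom {S Ω : Type*} (ζ : ℕ → Ω → ℝ) (Y : ℕ → S → Ω → ℝ) (i : ℕ) (x : S) (ω : Ω) : ℝ :=
  ζ i ω * Y i x ω

/-- The simple max-stable process `η(x) = max_i ζ_i Y_i(x)`. -/
def simpleMaxStable {S Ω : Type*} (ζ : ℕ → Ω → ℝ) (Y : ℕ → S → Ω → ℝ) (x : S) (ω : Ω) : ℝ :=
  ⨆ i, atom ζ Y i x ω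

/-- `X` is a max-stable process with spectral representation `(ζ, Y)`: up to deterministic
strictly increasing transformations `h x` of its margins, `X` has the same finite-dimensional
distributions as `η(x) = max_i ζ_i Y_i(x)`. The transformation `h x` has to be increasing only on
a set `A x` in which `X x` takes its values (for instance `h x z = -1 / z` on `A x = (-∞, 0)`). -/
structure IsMaxStable {S Ω Ω' : Type*} [MeasurableSpace Ω] [MeasurableSpace Ω']
    (X : S → Ω → ℝ) (P : Measure Ω) (ζ : ℕ → Ω' → ℝ) (Y : ℕ → S → Ω' → ℝ)
    (P' : Measure Ω') : Prop where
  spectral : IsSpectralRepresentation ζ Y P'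
  identDistrib : ∃ (A : S → Set ℝ) (h : S → ℝ → ℝ),
    (∀ x, MeasurableSet (A x) ∧ (∀ᵐ ω ∂P, X x ω ∈ A x) ∧ StrictMonoOn (h x) (A x)) ∧
    ∀ (n : ℕ) (t : Fin n → S),
      IdentDistrib (fun ω j => h (t j) (X (t j) ω))
        (fun ω j => simpleMaxStable ζ Y (t j) ω) P P'

/-- The sample concurrence probability `p_m(s_1, …, s_k)` of `X_1, …, X_m` (numbered from `0`):
the probability that some `X_l`, `l < m`, attains the maximum of the sample at all sites. -/
def sampleConcurrenceProb {S Ω : Type*} [MeasurableSpace Ω] (X : ℕ → S → Ω → ℝ) (P : Measure Ω)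
    {k : ℕ} (s : Fin k → S) (m : ℕ) : ℝ :=
  P.real {ω | ∃ l < m, ∀ j, ∀ i < m, X i (s j) ω ≤ X l (s j) ω}

/-- The extremal concurrence probability `p(s_1, …, s_k)`: the probability that a single atom
attains `η` at all sites. -/
def extremalConcurrenceProb {S Ω : Type*} [MeasurableSpace Ω] (ζ : ℕ → Ω → ℝ)
    (Y : ℕ → S → Ω → ℝ) (P : Measure Ω) {k : ℕ} (s : Fin k → S) : ℝ :=
  P.real {ω | ∃ l, ∀ j, simpleMaxStable ζ Y (s j) ω = atom ζ Y l (s j) ω}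

/-- The set of indices `i` which maximise `φ_i(x)`; almost surely it has one element. -/
def argMax {S Ω : Type*} (ζ : ℕ → Ω → ℝ) (Y : ℕ → S → Ω → ℝ) (x : S) (ω : Ω) : Set ℕ :=
  {i | ∀ l, atom ζ Y l x ω ≤ atom ζ Y i x ω}

/-- The extremal hitting scenario: the random partition of the indices of the sites (as an
equivalence relation) in which two indices are equivalent iff `φ_i` is maximised by the same `i`
at the two sites. -/
def hittingScenario {S Ω : Type*} (ζ : ℕ → Ω → ℝ) (Y : ℕ → S → Ω → ℝ) {k : ℕ}
    (s : Fin k → S) (ω : Ω) : Setoid (Fin k) :=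
  Setoid.ker (fun j => argMax ζ Y (s j) ω)

/-- The number of blocks of the extremal hitting scenario. -/
def numBlocks {S Ω : Type*} (ζ : ℕ → Ω → ℝ) (Y : ℕ → S → Ω → ℝ) {k : ℕ}
    (s : Fin k → S) (ω : Ω) : ℕ :=
  (hittingScenario ζ Y s ω).classes.ncard

end

end Concurrence

/-! ### Poisson laws, point counts and infinite products in `[0, 1]` -/

namespace Concurrence

open scoped ENNReal NNReal Topology

/-! Colour the atoms `φ_i` independently and uniformly with `m` colours. Thinning makes the `m`
colour classes independent Poisson processes of intensity divided by `m`. Since `z⁻² dz` is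
homogeneous of order -1, multiplying the atoms by `m` undoes this division. Hence the scaled maxima
over the colour classes are `m` independent copies of `η`, all built from one realisation
(`map_colouredMax`). This sample is concurrent exactly when the atoms that are maximal at the `k`
sites share a colour. Given `|π| = l`, these are `l` distinct atoms, and they share a colour with
probability `m · m⁻ˡ` (`pi_concurrenceSet`). Averaging over `π` gives the formula for `p_m`, with
`p` as the term `l = 1`; monotonicity, the bound and the asymptotics are read off from it.

Independence of the coloured maxima is a computation with distribution functions
(`measure_coloured_le`). Given the atoms, the probability that none breaks the bound of its colour
is a product over atoms, whose mean is the generating functional of a marked Poisson process. That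
functional is the exponential of a sum over colours. The margins of `X` play no role, because
strictly increasing maps preserve concurrence (`sampleConcurrenceProb_eq`). -/

lemma lintegral_poissonMeasure (r : ℝ≥0) (g : ℕ → ℝ≥0∞) :
    ∫⁻ n, g n ∂(poissonMeasure r)
      = ∑' n : ℕ, ENNReal.ofReal (Real.exp (-r) * r ^ n / n.factorial) * g n := by
  simp [poissonMeasure, lintegral_sum_measure, lintegral_smul_measure, lintegral_dirac]

lemma lintegral_pow_poissonMeasure (r u : ℝ≥0) :
    ∫⁻ n, (u : ℝ≥0∞) ^ n ∂(poissonMeasure r) = ENNReal.ofReal (Real.exp (-(r * (1 - u)))) := by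
  have h : ∀ n : ℕ, ENNReal.ofReal (Real.exp (-r) * r ^ n / n.factorial) * (u : ℝ≥0∞) ^ n
      = ENNReal.ofReal (Real.exp (-r) * ((r * u) ^ n / n.factorial)) := fun n => by
    rw [← ENNReal.ofReal_coe_nnreal, ← ENNReal.ofReal_pow u.coe_nonneg,
      ← ENNReal.ofReal_mul (by positivity)]
    ring_nf
  have hs := (NormedSpace.expSeries_div_hasSum_exp ((r * u : ℝ))).mul_left (Real.exp (-r))
  rw [lintegral_poissonMeasure, tsum_congr h,
    ← ENNReal.ofReal_tsum_of_nonneg (fun n => by positivity) hs.summable, hs.tsum_eq,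
    ← Real.exp_eq_exp_ℝ, ← Real.exp_add]
  ring_nf

lemma lintegral_natCast_poissonMeasure (r : ℝ≥0) :
    ∫⁻ n, (n : ℝ≥0∞) ∂(poissonMeasure r) = r := by
  have h : ∀ n : ℕ, ENNReal.ofReal (Real.exp (-r) * r ^ (n + 1) / (n + 1).factorial)
      * ((n + 1 : ℕ) : ℝ≥0∞) = r * ENNReal.ofReal (Real.exp (-r) * r ^ n / n.factorial) :=
    fun n => by
      rw [← ENNReal.ofReal_natCast, ← ENNReal.ofReal_mul (by positivity),
        ← ENNReal.ofReal_coe_nnreal, ← ENNReal.ofReal_mul (by positivity)]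
      congr 1
      rw [Nat.factorial_succ]
      push_cast
      field_simp
      ring
  have hs := hasSum_one_poissonMeasure r
  rw [lintegral_poissonMeasure, tsum_eq_zero_add' ENNReal.summable, tsum_congr h,
    ENNReal.tsum_mul_left, ← ENNReal.ofReal_tsum_of_nonneg (fun n => by positivity) hs.summable,
    hs.tsum_eq]
  simp

/-- `Measure.map` of a function that is not almost everywhere measurable is `0`, whereas a Poisson
law has mass one. So `map_count` already forces measurability. -/
lemma IsPoissonProcess.aemeasurable_pointCount {Ω : Type*} [MeasurableSpace Ω] {ζ : ℕ → Ω → ℝ}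
    {Λ : Measure ℝ} {P : Measure Ω} (hζ : IsPoissonProcess ζ Λ P) {A : Set ℝ}
    (hA : MeasurableSet A) (hΛ : Λ A ≠ ⊤) : AEMeasurable (pointCount ζ A) P := by
  by_contra h
  have h1 := hζ.map_count A hA hΛ
  rw [Measure.map_of_not_aemeasurable h] at h1
  have h2 : (poissonMeasure (Λ A).toNNReal).map (fun n : ℕ => (n : ℕ∞)) Set.univ = 1 :=
    measure_univ
  rw [← h1] at h2
  simp at h2

lemma IsPoissonProcess.lintegral_pointCount {Ω : Type*} [MeasurableSpace Ω] {ζ : ℕ → Ω → ℝ}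
    {Λ : Measure ℝ} {P : Measure Ω} (hζ : IsPoissonProcess ζ Λ P) {A : Set ℝ}
    (hA : MeasurableSet A) (hΛ : Λ A ≠ ⊤) (g : ℕ∞ → ℝ≥0∞) :
    ∫⁻ ω, g (pointCount ζ A ω) ∂P = ∫⁻ n : ℕ, g n ∂(poissonMeasure (Λ A).toNNReal) := by
  rw [← lintegral_map' (f := g) .of_discrete (hζ.aemeasurable_pointCount hA hΛ),
    hζ.map_count A hA hΛ, lintegral_map .of_discrete .of_discrete]

/-- Campbell's formula, as an inequality that needs no finiteness. -/
lemma IsPoissonProcess.tsum_measure_le {Ω : Type*} [MeasurableSpace Ω] {ζ : ℕ → Ω → ℝ}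
    {Λ : Measure ℝ} {P : Measure Ω} (hζ : IsPoissonProcess ζ Λ P) {A : Set ℝ}
    (hA : MeasurableSet A) : ∑' i, P (ζ i ⁻¹' A) ≤ Λ A := by
  by_cases hΛ : Λ A = ⊤
  · simp [hΛ]
  have h1 : ∀ ω, ∑' i, (ζ i ⁻¹' A).indicator (fun _ => (1 : ℝ≥0∞)) ω
      = (pointCount ζ A ω : ℝ≥0∞) := fun ω => by
    rw [pointCount, ← ENNReal.tsum_set_one, tsum_subtype {i : ℕ | ζ i ω ∈ A} (fun _ => 1)]
    rfl
  calc ∑' i, P (ζ i ⁻¹' A)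
      = ∑' i, ∫⁻ ω, (ζ i ⁻¹' A).indicator (fun _ => (1 : ℝ≥0∞)) ω ∂P := by
        simp [lintegral_indicator, hζ.measurable _ hA]
    _ = ∫⁻ ω, (pointCount ζ A ω : ℝ≥0∞) ∂P := by
        rw [← lintegral_tsum fun i =>
          (measurable_const.indicator (hζ.measurable i hA)).aemeasurable]
        simp_rw [h1]
    _ = Λ A := by
        rw [hζ.lintegral_pointCount hA hΛ (fun n => (n : ℝ≥0∞))]
        simp only [ENat.toENNReal_coe]
        rw [lintegral_natCast_poissonMeasure, ENNReal.coe_toNNReal hΛ]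
    _ ≤ Λ A := le_rfl

/-- With factors at most one the partial products decrease, so the unconditional product exists. As
a countable infimum it is open to measurability arguments and monotone convergence. -/
lemma tprod_eq_iInf_range {u : ℕ → ℝ≥0∞} (hu : ∀ i, u i ≤ 1) :
    ∏' i, u i = ⨅ n, ∏ i ∈ Finset.range n, u i := by
  have h1 : Antitone fun n => ∏ i ∈ Finset.range n, u i := fun a b hab =>
    Finset.prod_le_prod_of_subset_of_le_one' (Finset.range_mono hab) fun i _ _ => hu i
  have h2 : HasProd u (⨅ s : Finset ℕ, ∏ i ∈ s, u i) :=
    tendsto_atTop_iInf (Finset.prod_anti_set_of_le_one' hu)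
  rw [h2.tprod_eq]
  exact tendsto_nhds_unique h2.tendsto_prod_nat (tendsto_atTop_iInf h1)

lemma measurable_tprod_ennreal {Ω : Type*} [MeasurableSpace Ω] {u : ℕ → Ω → ℝ≥0∞}
    (hu : ∀ i ω, u i ω ≤ 1) (hm : ∀ i, Measurable (u i)) :
    Measurable fun ω => ∏' i, u i ω := by
  simp_rw [fun ω => tprod_eq_iInf_range fun i => hu i ω]
  exact Measurable.iInf fun n => Finset.measurable_prod _ fun i _ => hm i

lemma lintegral_tprod {Ω : Type*} [MeasurableSpace Ω] {P : Measure Ω} [IsProbabilityMeasure P]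
    {u : ℕ → Ω → ℝ≥0∞} (hu : ∀ i ω, u i ω ≤ 1) (hm : ∀ i, Measurable (u i))
    (hi : iIndepFun u P) :
    ∫⁻ ω, ∏' i, u i ω ∂P = ∏' i, ∫⁻ ω, u i ω ∂P := by
  have hu1 : ∀ i, ∫⁻ ω, u i ω ∂P ≤ 1 := fun i => by
    simpa using lintegral_mono (μ := P) (hu i)
  simp_rw [fun ω => tprod_eq_iInf_range fun i => hu i ω]
  rw [tprod_eq_iInf_range hu1, lintegral_iInf]
  · exact iInf_congr fun n => lintegral_prod_eq_prod_lintegral_of_indepFun _ _ hi hm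
  · exact fun n => Finset.measurable_prod _ fun i _ => hm i
  · exact fun a b hab ω =>
      Finset.prod_le_prod_of_subset_of_le_one' (Finset.range_mono hab) fun i _ _ => hu i ω
  · simp

end Concurrence

/-! ### The probability generating functional of a Poisson process -/

namespace Concurrence

open scoped ENNReal NNReal Topology

/-- The function `x ↦ exp (-x)` on `[0, ∞]`. -/
noncomputable def expNeg (x : ℝ≥0∞) : ℝ≥0∞ := EReal.exp (-(x : EReal))

lemma expNeg_coe (x : ℝ≥0) : expNeg x = ENNReal.ofReal (Real.exp (-x)) := by
  rw [expNeg, show ((x : ℝ≥0∞) : EReal) = ((x : ℝ) : EReal) from rfl, ← EReal.coe_neg,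
    EReal.exp_coe]

@[simp] lemma expNeg_zero : expNeg 0 = 1 := by simp [expNeg]

lemma expNeg_add (x y : ℝ≥0∞) : expNeg (x + y) = expNeg x * expNeg y := by
  rw [expNeg, expNeg, expNeg, ← EReal.exp_add, EReal.coe_ennreal_add]
  congr 1
  rw [EReal.neg_add, sub_eq_add_neg] <;> simp

lemma expNeg_sum {ι : Type*} (s : Finset ι) (x : ι → ℝ≥0∞) :
    expNeg (∑ i ∈ s, x i) = ∏ i ∈ s, expNeg (x i) := by
  classical
  induction s using Finset.induction_on with
  | empty => simp
  | insert a s ha ih => rw [Finset.sum_insert ha, Finset.prod_insert ha, expNeg_add, ih]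

lemma continuous_expNeg : Continuous expNeg :=
  ENNReal.continuous_exp.comp (continuous_neg.comp continuous_coe_ennreal_ereal)

variable {Ω : Type*} [MeasurableSpace Ω] {ζ : ℕ → Ω → ℝ} {Λ : Measure ℝ} {P : Measure Ω}

lemma IsPoissonProcess.lintegral_pow_pointCount (hζ : IsPoissonProcess ζ Λ P) {A : Set ℝ}
    (hA : MeasurableSet A) (hΛ : Λ A ≠ ⊤) {v : ℝ≥0∞} (hv : v ≤ 1) :
    ∫⁻ ω, (1 - v) ^ (pointCount ζ A ω).toNat ∂P = expNeg (v * Λ A) := by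
  lift v to ℝ≥0 using (hv.trans_lt ENNReal.one_lt_top).ne
  lift Λ A to ℝ≥0 using hΛ with r hr
  have hv' : v ≤ 1 := by exact_mod_cast hv
  rw [hζ.lintegral_pointCount hA (by simp [← hr]) (fun n => (1 - (v : ℝ≥0∞)) ^ n.toNat)]
  simp only [ENat.toNat_natCast, ← hr, ENNReal.toNNReal_coe]
  have := lintegral_pow_poissonMeasure r (1 - v)
  rw [ENNReal.coe_sub, ENNReal.coe_one] at this
  rw [this, ← ENNReal.coe_mul, expNeg_coe, NNReal.coe_sub hv']
  congr 2
  push_cast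
  ring

/-- The set of indices of points in a set of finite intensity is almost surely finite. -/
lemma IsPoissonProcess.ae_finite (hζ : IsPoissonProcess ζ Λ P) {A : Set ℝ}
    (hA : MeasurableSet A) (hΛ : Λ A ≠ ⊤) : ∀ᵐ ω ∂P, {i | ζ i ω ∈ A}.Finite :=
  ae_finite_setOfPred_mem ((hζ.tsum_measure_le hA).trans_lt hΛ.lt_top).ne

/-- Grouping the points by the value `v` of `h` turns the product into a finite product of `(1 - v)
^ N_v`, where the `N_v` count points in disjoint level sets and are therefore independent Poisson
variables. The value `0` is left out: it contributes a factor one, and its level set may have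
infinite intensity. -/
lemma IsPoissonProcess.lintegral_tprod_simple (hζ : IsPoissonProcess ζ Λ P)
    (h : SimpleFunc ℝ ℝ≥0∞) (h1 : ∀ z, h z ≤ 1) (hfin : Λ {z | h z ≠ 0} ≠ ⊤) :
    ∫⁻ ω, ∏' i, (1 - h (ζ i ω)) ∂P = expNeg (∫⁻ z, h z ∂Λ) := by
  classical
  set R := h.range.filter (· ≠ 0) with hR
  let e := R.equivFin.symm
  have hv1 : ∀ v ∈ R, v ≤ 1 := fun v hv => by
    obtain ⟨z, rfl⟩ := SimpleFunc.mem_range.1 (Finset.mem_filter.1 hv).1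
    exact h1 z
  have hvfin : ∀ v ∈ R, Λ (h ⁻¹' {v}) ≠ ⊤ := fun v hv =>
    ne_top_of_le_ne_top hfin (measure_mono fun z hz => by
      simp only [Set.mem_preimage, Set.mem_singleton_iff] at hz
      simpa [hz] using (Finset.mem_filter.1 hv).2)
  have hm : ∀ v, MeasurableSet (h ⁻¹' {v}) := fun v => h.measurableSet_preimage _
  have hprod : ∀ᵐ ω ∂P, ∏' i, (1 - h (ζ i ω))
      = ∏ n, (1 - (e n : ℝ≥0∞)) ^ (pointCount ζ (h ⁻¹' {(e n : ℝ≥0∞)}) ω).toNat := by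
    have hsupp : MeasurableSet {z | h z ≠ 0} := (h.measurableSet_preimage {0}).compl
    filter_upwards [hζ.ae_finite hsupp hfin] with ω hω
    have hT : ∀ i ∉ hω.toFinset, 1 - h (ζ i ω) = 1 := fun i hi => by
      have : h (ζ i ω) = 0 := by simpa using hi
      simp [this]
    rw [tprod_eq_prod hT,
      Fintype.prod_equiv e _ (fun v : R => (1 - (v : ℝ≥0∞)) ^
        (pointCount ζ (h ⁻¹' {(v : ℝ≥0∞)}) ω).toNat) (fun n => rfl),
      Finset.prod_coe_sort R (fun v => (1 - v) ^ (pointCount ζ (h ⁻¹' {v}) ω).toNat),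
      ← Finset.prod_fiberwise_of_maps_to (g := fun i => h (ζ i ω)) (t := R) (fun i hi => by
        simpa [hR] using hi)]
    refine Finset.prod_congr rfl fun v hv => ?_
    rw [Finset.prod_congr rfl (g := fun _ => 1 - v)
      (fun i hi => by rw [(Finset.mem_filter.1 hi).2]), Finset.prod_const]
    congr 1
    rw [pointCount, ← Set.ncard_def, ← Set.ncard_coe_finset]
    congr 1
    ext i
    have hv0 := (Finset.mem_filter.1 hv).2
    simp only [Finset.coe_filter, Set.Finite.mem_toFinset, Set.mem_ofPred_eq, Set.mem_preimage,
      Set.mem_singleton_iff]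
    exact ⟨fun hi => hi.2, fun hi => ⟨hi ▸ hv0, hi⟩⟩
  have hind := hζ.indep_count R.card (fun n => h ⁻¹' {(e n : ℝ≥0∞)}) (fun n => hm _)
    (fun a b hab => Disjoint.preimage _ (by
      simpa [Subtype.val_injective.eq_iff] using hab))
  have hind' := hind.comp (fun n x => (1 - (e n : ℝ≥0∞)) ^ x.toNat) (fun n => .of_discrete)
  have haem : ∀ n, AEMeasurable (fun ω =>
      (1 - (e n : ℝ≥0∞)) ^ (pointCount ζ (h ⁻¹' {(e n : ℝ≥0∞)}) ω).toNat) P := fun n =>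
    (Measurable.of_discrete (f := fun x : ℕ∞ => (1 - (e n : ℝ≥0∞)) ^ x.toNat)).comp_aemeasurable
      (hζ.aemeasurable_pointCount (hm _) (hvfin _ (e n).2))
  -- The counts are only almost everywhere measurable, so the product formula is applied to
  -- measurable modifications.
  have hmk := lintegral_prod_eq_prod_lintegral_of_indepFun Finset.univ
    (fun n => (haem n).mk _) (hind'.congr fun n => (haem n).ae_eq_mk)
    (fun n => (haem n).measurable_mk)
  have hmk' : ∀ᵐ ω ∂P, ∀ n, (1 - (e n : ℝ≥0∞)) ^
      (pointCount ζ (h ⁻¹' {(e n : ℝ≥0∞)}) ω).toNat = (haem n).mk _ ω :=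
    ae_all_iff.2 fun n => (haem n).ae_eq_mk
  rw [lintegral_congr_ae hprod, lintegral_congr_ae (g := fun ω => ∏ n, (haem n).mk _ ω)
    (hmk'.mono fun ω hω => Finset.prod_congr rfl fun n _ => hω n), hmk,
    SimpleFunc.lintegral_eq_lintegral, SimpleFunc.lintegral]
  rw [← Finset.sum_filter_of_ne (p := (· ≠ 0)) (fun v _ hv => left_ne_zero_of_mul hv), expNeg_sum,
    ← hR, ← Finset.prod_coe_sort R, ← Fintype.prod_equiv e _ _ (fun n => rfl)]
  refine Finset.prod_congr rfl fun n _ => ?_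
  rw [← hζ.lintegral_pow_pointCount (hm _) (hvfin _ (e n).2) (hv1 _ (e n).2)]
  exact lintegral_congr_ae (haem n).ae_eq_mk.symm

/-- The probability generating functional of a Poisson process. -/
lemma IsPoissonProcess.lintegral_tprod [IsProbabilityMeasure P] [SigmaFinite Λ]
    (hζ : IsPoissonProcess ζ Λ P)
    {h : ℝ → ℝ≥0∞} (hm : Measurable h) (h1 : ∀ z, h z ≤ 1) :
    ∫⁻ ω, ∏' i, (1 - h (ζ i ω)) ∂P = expNeg (∫⁻ z, h z ∂Λ) := by
  -- Simple functions increasing to `h`, cut off to spanning sets so that their supports have finite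
  -- intensity.
  let g : ℕ → SimpleFunc ℝ ℝ≥0∞ := fun n =>
    (SimpleFunc.eapprox h n).restrict (spanningSets Λ n)
  have hg : ∀ n z, g n z = (spanningSets Λ n).indicator (SimpleFunc.eapprox h n) z := fun n z =>
    SimpleFunc.restrict_apply _ (measurableSet_spanningSets Λ n) z
  have hmono : Monotone fun n z => g n z := fun a b hab z => by
    simp only [hg]
    exact (Set.indicator_le_indicator_of_subset (monotone_spanningSets Λ hab)
      (fun _ => zero_le) z).trans
        (Set.indicator_le_indicator (SimpleFunc.monotone_eapprox h hab z))
  have hle : ∀ n z, g n z ≤ h z := fun n z => by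
    rw [hg]
    refine (Set.indicator_le_self' (fun _ _ => zero_le) z).trans ?_
    rw [← SimpleFunc.iSup_eapprox_apply hm z]
    exact le_iSup (fun n => SimpleFunc.eapprox h n z) n
  have htend : ∀ z, Tendsto (fun n => g n z) atTop (𝓝 (h z)) := fun z => by
    have := tendsto_atTop_iSup (fun a b hab => SimpleFunc.monotone_eapprox h hab z)
    rw [SimpleFunc.iSup_eapprox_apply hm z] at this
    refine this.congr' ?_
    obtain ⟨N, hN⟩ := Set.mem_iUnion.1 ((iUnion_spanningSets Λ).symm ▸ Set.mem_univ z)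
    filter_upwards [eventually_ge_atTop N] with n hn
    rw [hg, Set.indicator_of_mem (monotone_spanningSets Λ hn hN)]
  have hgfin : ∀ n, Λ {z | g n z ≠ 0} ≠ ⊤ := fun n =>
    ne_top_of_le_ne_top (measure_spanningSets_lt_top Λ n).ne (measure_mono fun z hz => by
      by_contra hz'
      exact hz (by rw [hg, Set.indicator_of_notMem hz']))
  have hsimple := fun n => hζ.lintegral_tprod_simple (g n) (fun z => (hle n z).trans (h1 z))
    (hgfin n)
  have hR : Tendsto (fun n => expNeg (∫⁻ z, g n z ∂Λ)) atTop (𝓝 (expNeg (∫⁻ z, h z ∂Λ))) :=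
    (continuous_expNeg.tendsto _).comp (lintegral_tendsto_of_tendsto_of_monotone
      (fun n => (g n).measurable.aemeasurable)
      (ae_of_all _ fun z a b hab => hmono hab z) (ae_of_all _ htend))
  have hle1 : ∀ x : ℝ≥0∞, 1 - x ≤ 1 := fun x => tsub_le_self
  have hanti : Antitone fun n z => 1 - g n z := fun a b hab z => tsub_le_tsub_left (hmono hab z) _
  have hL : Tendsto (fun n => ∫⁻ ω, ∏' i, (1 - g n (ζ i ω)) ∂P) atTop
      (𝓝 (∫⁻ ω, ∏' i, (1 - h (ζ i ω)) ∂P)) := by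
    refine lintegral_tendsto_of_tendsto_of_antitone (fun n => ?_) (ae_of_all _ fun ω => ?_) ?_
      (ae_of_all _ fun ω => ?_)
    · exact (measurable_tprod_ennreal (fun _ _ => hle1 _) fun i =>
        ((g n).measurable.comp (hζ.measurable i)).const_sub 1).aemeasurable
    · intro a b hab
      simp only [tprod_eq_iInf_range fun i => hle1 _]
      exact iInf_mono fun n => Finset.prod_le_prod' fun i _ => hanti hab _
    · refine ne_top_of_le_ne_top ENNReal.one_ne_top ?_
      refine (lintegral_mono (g := fun _ => 1) fun ω => ?_).trans (by simp)
      rw [tprod_eq_iInf_range fun i => hle1 _]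
      exact (iInf_le _ 0).trans (by simp)
    -- Both the infinite product and the limit in `n` are infima, so they can be interchanged,
    -- leaving a limit of finite products.
    · have hlim : ∏' i, (1 - h (ζ i ω)) = ⨅ n, ∏' i, (1 - g n (ζ i ω)) := by
        simp only [tprod_eq_iInf_range fun i => hle1 _]
        rw [iInf_comm]
        refine iInf_congr fun N => ?_
        refine tendsto_nhds_unique (ENNReal.tendsto_finsetProd_of_ne_top _ (fun i _ => ?_)
          (fun i _ => (hle1 _).trans_lt ENNReal.one_lt_top |>.ne)) (tendsto_atTop_iInf ?_)
        · exact ENNReal.Tendsto.sub tendsto_const_nhds (htend _) (Or.inl ENNReal.one_ne_top)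
        · exact fun a b hab => Finset.prod_le_prod' fun i _ => hanti hab _
      rw [hlim]
      refine tendsto_atTop_iInf fun a b hab => ?_
      simp only [tprod_eq_iInf_range fun i => hle1 _]
      exact iInf_mono fun n => Finset.prod_le_prod' fun i _ => hanti hab _
  exact tendsto_nhds_unique hL (by simpa only [hsimple] using hR)

end Concurrence

/-! ### Independent marks -/

namespace Concurrence

open scoped ENNReal NNReal Topology

section Marked

variable {Ω E : Type*} [MeasurableSpace Ω] [MeasurableSpace E] {ζ : ℕ → Ω → ℝ} {y : ℕ → Ω → E}
  {Λ : Measure ℝ} {P : Measure Ω} [IsProbabilityMeasure P]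

lemma lintegral_infinitePi_tprod (μ : Measure E) [IsProbabilityMeasure μ] {f : ℕ → E → ℝ≥0∞}
    (hf : ∀ i, Measurable (f i)) (h1 : ∀ i e, f i e ≤ 1) :
    ∫⁻ e, ∏' i, f i (e i) ∂(Measure.infinitePi fun _ : ℕ => μ) = ∏' i, ∫⁻ e, f i e ∂μ := by
  have hi := iIndepFun_infinitePi (P := fun _ : ℕ => μ) hf
  refine (lintegral_tprod (u := fun i (e : ℕ → E) => f i (e i)) (fun i e => h1 i _)
    (fun i => (hf i).comp (measurable_pi_apply i)) hi).trans ?_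
  exact tprod_congr fun i =>
    (measurePreserving_eval_infinitePi (fun _ : ℕ => μ) i).lintegral_comp (hf i)

/-- The probability generating functional of an independently marked Poisson process. -/
lemma IsPoissonProcess.lintegral_tprod_marked [SigmaFinite Λ] (hζ : IsPoissonProcess ζ Λ P)
    (hy : ∀ i, Measurable (y i)) (hi : iIndepFun y P)
    (hid : ∀ i, P.map (y i) = P.map (y 0))
    (hind : IndepFun (fun ω i => ζ i ω) (fun ω i => y i ω) P)
    {f : ℝ × E → ℝ≥0∞} (hf : Measurable f) (h1 : ∀ p, f p ≤ 1) :
    ∫⁻ ω, ∏' i, (1 - f (ζ i ω, y i ω)) ∂P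
      = expNeg (∫⁻ z, ∫⁻ e, f (z, e) ∂(P.map (y 0)) ∂Λ) := by
  set μ := P.map (y 0)
  have : IsProbabilityMeasure μ := Measure.isProbabilityMeasure_map (hy 0).aemeasurable
  have hζm : Measurable fun ω i => ζ i ω := measurable_pi_lambda _ hζ.measurable
  have hym : Measurable fun ω i => y i ω := measurable_pi_lambda _ hy
  have hle1 : ∀ x : ℝ≥0∞, 1 - x ≤ 1 := fun x => tsub_le_self
  have hlaw : P.map (fun ω => ((fun i => ζ i ω), fun i => y i ω))
      = (P.map fun ω i => ζ i ω).prod (Measure.infinitePi fun _ : ℕ => μ) := by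
    rw [(indepFun_iff_map_prod_eq_prod_map_map hζm.aemeasurable hym.aemeasurable).1 hind,
      hi.map_fun_eq_infinitePi_map hy, funext hid]
  have hmp : Measurable fun p : (ℕ → ℝ) × (ℕ → E) => ∏' i, (1 - f (p.1 i, p.2 i)) :=
    measurable_tprod_ennreal (fun _ _ => hle1 _) fun i => (hf.comp (by fun_prop)).const_sub 1
  have hfb : Measurable fun z => ∫⁻ e, f (z, e) ∂μ := hf.lintegral_prod_right'
  have hfb1 : ∀ z, ∫⁻ e, f (z, e) ∂μ ≤ 1 := fun z => by
    simpa using lintegral_mono (μ := μ) fun e => h1 (z, e)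
  have : IsProbabilityMeasure (P.map fun ω i => ζ i ω) :=
    Measure.isProbabilityMeasure_map hζm.aemeasurable
  -- With the points frozen, the marks integrate out factor by factor. What remains is the unmarked
  -- functional at the mark average of `f`.
  rw [← hζ.lintegral_tprod hfb hfb1,
    ← lintegral_map (f := fun p : (ℕ → ℝ) × (ℕ → E) => ∏' i, (1 - f (p.1 i, p.2 i)))
      (g := fun ω => ((fun i => ζ i ω), fun i => y i ω)) hmp (hζm.prodMk hym), hlaw,
    lintegral_prod _ hmp.aemeasurable,
    ← lintegral_map (f := fun z : ℕ → ℝ => ∏' i, (1 - ∫⁻ e, f (z i, e) ∂μ))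
      (g := fun ω i => ζ i ω) (measurable_tprod_ennreal (fun _ _ => hle1 _) fun i =>
        (hfb.comp (measurable_pi_apply i)).const_sub 1) hζm]
  refine lintegral_congr fun z => ?_
  have hfz : ∀ i, Measurable fun e => f (z i, e) := fun i => hf.comp (by fun_prop)
  rw [lintegral_infinitePi_tprod μ (f := fun i e => 1 - f (z i, e))
    (fun i => (hfz i).const_sub 1) fun _ _ => hle1 _]
  refine tprod_congr fun i => ?_
  rw [lintegral_sub (hfz i) ((hfb1 _).trans_lt ENNReal.one_lt_top).ne (ae_of_all _ fun e => h1 _)]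
  simp

/-- Each point is independent of its mark and all marks have the same law. So the mark can be frozen
and `tsum_measure_le` applied to each section of `B`. -/
lemma IsPoissonProcess.tsum_measure_marked_le (hζ : IsPoissonProcess ζ Λ P)
    (hy : ∀ i, Measurable (y i)) (hid : ∀ i, P.map (y i) = P.map (y 0))
    (hind : IndepFun (fun ω i => ζ i ω) (fun ω i => y i ω) P)
    {B : Set (ℝ × E)} (hB : MeasurableSet B) :
    ∑' i, P {ω | (ζ i ω, y i ω) ∈ B} ≤ ∫⁻ e, Λ {z | (z, e) ∈ B} ∂(P.map (y 0)) := by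
  set μ := P.map (y 0)
  have : IsProbabilityMeasure μ := Measure.isProbabilityMeasure_map (hy 0).aemeasurable
  have h1 : ∀ i, P {ω | (ζ i ω, y i ω) ∈ B} = ∫⁻ e, P.map (ζ i) {z | (z, e) ∈ B} ∂μ :=
    fun i => by
      have hi := hind.comp (measurable_pi_apply i) (measurable_pi_apply i)
      have : IsProbabilityMeasure (P.map (ζ i)) :=
        Measure.isProbabilityMeasure_map (hζ.measurable i).aemeasurable
      have h2 : P {ω | (ζ i ω, y i ω) ∈ B} = P.map (fun ω => (ζ i ω, y i ω)) B :=
        (Measure.map_apply ((hζ.measurable i).prodMk (hy i)) hB).symm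
      rw [h2, (indepFun_iff_map_prod_eq_prod_map_map (hζ.measurable i).aemeasurable
        (hy i).aemeasurable).1 hi, hid i, Measure.prod_apply_symm hB]
      rfl
  have hmeas : ∀ i, Measurable fun e => P.map (ζ i) {z | (z, e) ∈ B} := fun i =>
    measurable_measure_prodMk_right hB
  simp_rw [h1]
  rw [← lintegral_tsum fun i => (hmeas i).aemeasurable]
  refine lintegral_mono fun e => ?_
  have hBe : MeasurableSet {z | (z, e) ∈ B} := hB.preimage (by fun_prop)
  refine le_trans (le_of_eq (tsum_congr fun i => ?_)) (hζ.tsum_measure_le hBe)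
  exact Measure.map_apply (hζ.measurable i) hBe

end Marked

/-! ### The intensity `z⁻² dz` and its homogeneity -/

section Frechet

lemma measurable_frechetDensity :
    Measurable fun z : ℝ => ENNReal.ofReal ((z ^ 2)⁻¹) := by fun_prop

instance : SigmaFinite frechetIntensity := by
  unfold frechetIntensity
  exact SigmaFinite.withDensity_ofReal _

lemma frechetIntensity_apply {A : Set ℝ} (hA : MeasurableSet A) :
    frechetIntensity A = ∫⁻ z in A ∩ Set.Ioi 0, ENNReal.ofReal ((z ^ 2)⁻¹) := by
  rw [frechetIntensity, withDensity_apply _ hA, Measure.restrict_restrict hA]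

lemma frechetIntensity_Iic : frechetIntensity (Set.Iic 0) = 0 := by
  rw [frechetIntensity_apply measurableSet_Iic]
  have : Set.Iic (0 : ℝ) ∩ Set.Ioi 0 = ∅ := by ext; simp
  simp [this]

lemma frechetIntensity_Ioi {t : ℝ} (ht : 0 < t) :
    frechetIntensity (Set.Ioi t) = ENNReal.ofReal t⁻¹ := by
  have h2 : ∀ z ∈ Set.Ioi t, z ^ (-2 : ℝ) = (z ^ 2)⁻¹ := fun z hz => by
    rw [Real.rpow_neg (ht.trans hz).le]
    norm_cast
  rw [frechetIntensity_apply measurableSet_Ioi,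
    Set.inter_eq_left.2 (Set.Ioi_subset_Ioi ht.le),
    setLIntegral_congr_fun measurableSet_Ioi (g := fun z => ENNReal.ofReal (z ^ (-2 : ℝ)))
      (fun z hz => by simp only [h2 z hz]),
    ← ofReal_integral_eq_lintegral_ofReal (integrableOn_Ioi_rpow_of_lt (by norm_num) ht)
      ((ae_restrict_mem measurableSet_Ioi).mono fun z hz => Real.rpow_nonneg (ht.trans hz).le _),
    integral_Ioi_rpow_of_lt (by norm_num) ht]
  congr 1
  norm_num
  exact Real.rpow_neg_one t

/-- The density contributes `c²` and the Jacobian `c⁻¹`. This homogeneity is what lets scaling by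
`m` compensate for thinning by `1 / m`. -/
lemma frechetIntensity_preimage_mul {c : ℝ} (hc : 0 < c) {A : Set ℝ} (hA : MeasurableSet A) :
    frechetIntensity ((c * ·) ⁻¹' A) = ENNReal.ofReal c * frechetIntensity A := by
  have hm : Measurable (c * · : ℝ → ℝ) := by fun_prop
  rw [frechetIntensity_apply (hA.preimage hm), frechetIntensity_apply hA,
    ← lintegral_indicator ((hA.preimage hm).inter measurableSet_Ioi),
    ← lintegral_indicator (hA.inter measurableSet_Ioi)]
  set g : ℝ → ℝ≥0∞ := (A ∩ Set.Ioi 0).indicator fun z => ENNReal.ofReal ((z ^ 2)⁻¹) with hg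
  have hgm : Measurable g := measurable_frechetDensity.indicator (hA.inter measurableSet_Ioi)
  have h1 : ((fun x => c * x) ⁻¹' A ∩ Set.Ioi 0).indicator
      (fun z => ENNReal.ofReal ((z ^ 2)⁻¹)) = fun z => ENNReal.ofReal (c ^ 2) * g (c * z) := by
    ext z
    have hiff : z ∈ (fun x => c * x) ⁻¹' A ∩ Set.Ioi 0 ↔ c * z ∈ A ∩ Set.Ioi 0 := by
      simp [mul_pos_iff_of_pos_left hc]
    by_cases hz : c * z ∈ A ∩ Set.Ioi 0
    · rw [hg, Set.indicator_of_mem hz, Set.indicator_of_mem (hiff.2 hz),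
        ← ENNReal.ofReal_mul (by positivity)]
      congr 1
      have : z ≠ 0 := ne_of_gt (hiff.2 hz).2
      field_simp
    · rw [hg, Set.indicator_of_notMem hz, Set.indicator_of_notMem (fun h => hz (hiff.1 h)),
        mul_zero]
  rw [h1, lintegral_const_mul _ (f := fun z => g (c * z)) (hgm.comp hm), ← lintegral_map hgm hm,
    Real.map_volume_mul_left hc.ne', lintegral_smul_measure, smul_eq_mul, ← mul_assoc,
    ← ENNReal.ofReal_mul (by positivity), abs_of_pos (inv_pos.2 hc)]
  congr 2
  field_simp

/-- The intensity of the points that a nonnegative factor `a` moves above the level `x`. -/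
lemma frechetIntensity_lt_mul {a x : ℝ} (ha : 0 ≤ a) (hx : 0 < x) :
    frechetIntensity {z | x < z * a} = ENNReal.ofReal a * ENNReal.ofReal x⁻¹ := by
  rcases ha.eq_or_lt with rfl | ha
  · simp [not_lt.2 hx.le]
  · have : {z : ℝ | x < z * a} = (a * ·) ⁻¹' Set.Ioi x := by ext z; simp [mul_comm]
    rw [this, frechetIntensity_preimage_mul ha measurableSet_Ioi, frechetIntensity_Ioi hx]

end Frechet

end Concurrence

/-! ### Spectral representations and coloured atoms -/

namespace Concurrence

open scoped ENNReal NNReal Topology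

section Spectral

variable {Ω κ : Type*} [MeasurableSpace Ω] {ζ : ℕ → Ω → ℝ} {Y : ℕ → κ → Ω → ℝ}
  {P : Measure Ω}

lemma measurable_reindex {S : Type*} (s : κ → S) :
    Measurable fun (f : S → ℝ) (j : κ) => f (s j) :=
  measurable_pi_lambda _ fun j => measurable_pi_apply (s j)

lemma IsIIDCopies.reindex {S : Type*} {Z : ℕ → S → Ω → ℝ} (hZ : IsIIDCopies Z P) (s : κ → S) :
    IsIIDCopies (fun i j => Z i (s j)) P where
  measurable i j := hZ.measurable i (s j)
  indep := hZ.indep.comp (fun _ f j => f (s j)) fun _ => measurable_reindex s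
  identDistrib i := (hZ.identDistrib i).comp (measurable_reindex s)

/-- Restricts to the finitely many sites in play, where events over all sites are measurable. -/
lemma IsSpectralRepresentation.reindex {S : Type*} {Y : ℕ → S → Ω → ℝ}
    (h : IsSpectralRepresentation ζ Y P) (s : κ → S) :
    IsSpectralRepresentation ζ (fun i j => Y i (s j)) P where
  poisson := h.poisson
  iid := h.iid.reindex s
  indep := h.indep.comp measurable_id (measurable_pi_lambda
    (fun (f : ℕ → S → ℝ) i (j : κ) => f i (s j)) fun i =>
      (measurable_reindex s).comp (measurable_pi_apply i))
  nonneg i j := h.nonneg i (s j)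
  mean_one j := h.mean_one (s j)

/-- The law of the spectral functions. -/
noncomputable def spectralLaw (Y : ℕ → κ → Ω → ℝ) (P : Measure Ω) : Measure (κ → ℝ) :=
  P.map fun ω j => Y 0 j ω

/-- The exponent measure of the set of functions that exceed `x` at some site. -/
noncomputable def exponent (μ : Measure (κ → ℝ)) (x : κ → ℝ) : ℝ≥0∞ :=
  ∫⁻ e, frechetIntensity {z | ∃ j, x j < z * e j} ∂μ

lemma IsIIDCopies.measurable_path (h : IsIIDCopies Y P) (i : ℕ) :
    Measurable fun ω j => Y i j ω := measurable_pi_lambda _ (h.measurable i)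

lemma IsSpectralRepresentation.measurable_atom (h : IsSpectralRepresentation ζ Y P) (i : ℕ)
    (j : κ) : Measurable (atom ζ Y i j) :=
  (h.poisson.measurable i).mul (h.iid.measurable i j)

lemma IsSpectralRepresentation.measurable_simpleMaxStable
    (h : IsSpectralRepresentation ζ Y P) (j : κ) : Measurable (simpleMaxStable ζ Y j) :=
  Measurable.iSup fun i => h.measurable_atom i j

lemma IsSpectralRepresentation.ae_pos (h : IsSpectralRepresentation ζ Y P) :
    ∀ᵐ ω ∂P, ∀ i, 0 < ζ i ω := by
  refine ae_all_iff.2 fun i => ?_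
  have h1 := (ENNReal.le_tsum i).trans (h.poisson.tsum_measure_le (measurableSet_Iic (a := 0)))
  rw [frechetIntensity_Iic, nonpos_iff_eq_zero] at h1
  simpa [ae_iff, Set.preimage, Set.Iic] using h1

lemma IsSpectralRepresentation.ae_atom_nonneg (h : IsSpectralRepresentation ζ Y P) (j : κ) :
    ∀ᵐ ω ∂P, ∀ i, 0 ≤ atom ζ Y i j ω := by
  filter_upwards [h.ae_pos, ae_all_iff.2 fun i => h.nonneg i j] with ω h1 h2 i
  exact mul_nonneg (h1 i).le (h2 i)

lemma IsSpectralRepresentation.ae_spectralLaw_nonneg (h : IsSpectralRepresentation ζ Y P)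
    (j : κ) : ∀ᵐ e ∂(spectralLaw Y P), 0 ≤ e j :=
  (ae_map_iff (h.iid.measurable_path 0).aemeasurable
    (measurableSet_le measurable_const (measurable_pi_apply j))).2 (h.nonneg 0 j)

lemma IsSpectralRepresentation.lintegral_spectralLaw (h : IsSpectralRepresentation ζ Y P)
    (j : κ) : ∫⁻ e, ENNReal.ofReal (e j) ∂(spectralLaw Y P) = 1 := by
  -- The Bochner integral of a non-integrable function is `0`, so mean one forces integrability.
  have hint : Integrable (Y 0 j) P := by
    by_contra h1
    exact zero_ne_one ((integral_undef h1).symm.trans (h.mean_one j))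
  rw [spectralLaw, lintegral_map (by fun_prop) (h.iid.measurable_path 0),
    ← ofReal_integral_eq_lintegral_ofReal hint (h.nonneg 0 j), h.mean_one j, ENNReal.ofReal_one]

lemma IsSpectralRepresentation.lintegral_frechetIntensity
    (h : IsSpectralRepresentation ζ Y P) (j : κ) {x : ℝ} (hx : 0 < x) :
    ∫⁻ e, frechetIntensity {z | x < z * e j} ∂(spectralLaw Y P) = ENNReal.ofReal x⁻¹ := by
  rw [lintegral_congr_ae ((h.ae_spectralLaw_nonneg j).mono fun e he =>
    frechetIntensity_lt_mul he hx), lintegral_mul_const _ (by fun_prop),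
    h.lintegral_spectralLaw j, one_mul]

lemma IsIIDCopies.map_path (h : IsIIDCopies Y P) (i : ℕ) :
    P.map (fun ω j => Y i j ω) = spectralLaw Y P := (h.identDistrib i).map_eq

variable [IsProbabilityMeasure P]

/-- The expected number of atoms above `1 / (n + 1)` is at most `n + 1`, so Borel–Cantelli applies
at each of these countably many levels. -/
lemma IsSpectralRepresentation.ae_finite (h : IsSpectralRepresentation ζ Y P) (j : κ) :
    ∀ᵐ ω ∂P, ∀ ε > 0, {i | ε < atom ζ Y i j ω}.Finite := by
  have h1 : ∀ n : ℕ, ∀ᵐ ω ∂P, {i | 1 / (n + 1 : ℝ) < atom ζ Y i j ω}.Finite := fun n => by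
    refine ae_finite_setOfPred_mem (ne_top_of_le_ne_top (b := ENNReal.ofReal (n + 1)) (by simp) ?_)
    have hB : MeasurableSet {p : ℝ × (κ → ℝ) | 1 / (n + 1 : ℝ) < p.1 * p.2 j} :=
      measurableSet_lt measurable_const (by fun_prop)
    refine (h.poisson.tsum_measure_marked_le h.iid.measurable_path h.iid.map_path h.indep
      hB).trans (le_of_eq ?_)
    have := h.lintegral_frechetIntensity j (x := 1 / (n + 1 : ℝ)) (by positivity)
    rw [one_div, inv_inv] at this
    simpa [spectralLaw] using this
  filter_upwards [ae_all_iff.2 h1] with ω hω ε hε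
  obtain ⟨n, hn⟩ := exists_nat_one_div_lt hε
  exact (hω n).subset fun i (hi : ε < _) => hn.trans hi

lemma IsSpectralRepresentation.ae_bddAbove (h : IsSpectralRepresentation ζ Y P) (j : κ) :
    ∀ᵐ ω ∂P, BddAbove (Set.range fun i => atom ζ Y i j ω) := by
  filter_upwards [h.ae_finite j] with ω hω
  refine (((hω 1 one_pos).image fun i => atom ζ Y i j ω).bddAbove.union
    (bddAbove_Iic (a := (1 : ℝ)))).mono ?_
  rintro _ ⟨i, rfl⟩
  rcases lt_or_ge 1 (atom ζ Y i j ω) with hi | hi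
  · exact Or.inl ⟨i, hi, rfl⟩
  · exact Or.inr hi

/-- The uniform distribution on `m` colours. -/
noncomputable def colourLaw (m : ℕ) : Measure (Fin m) := (m : ℝ≥0∞)⁻¹ • Measure.count

lemma colourLaw_apply (m : ℕ) (G : Set (Fin m)) :
    colourLaw m G = (m : ℝ≥0∞)⁻¹ * ∑ a, G.indicator (fun _ => 1) a := by
  rw [colourLaw, Measure.smul_apply, smul_eq_mul, ← lintegral_indicator_one .of_discrete,
    lintegral_count, tsum_fintype]
  rfl

lemma colourLaw_singleton (m : ℕ) (a : Fin m) : colourLaw m {a} = (m : ℝ≥0∞)⁻¹ := by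
  simp [colourLaw]

instance (m : ℕ) [NeZero m] : IsProbabilityMeasure (colourLaw m) :=
  ⟨by simp [colourLaw_apply, ENNReal.inv_mul_cancel, NeZero.ne]⟩

/-- The law of independent uniform colours of the atoms. -/
noncomputable def colouringLaw (m : ℕ) [NeZero m] : Measure (ℕ → Fin m) :=
  Measure.infinitePi fun _ => colourLaw m

instance (m : ℕ) [NeZero m] : IsProbabilityMeasure (colouringLaw m) := by
  unfold colouringLaw; infer_instance

variable [Countable κ]

lemma measurableSet_exists_lt_mul (x : κ → ℝ) (c : ℝ) :
    MeasurableSet {p : ℝ × (κ → ℝ) | ∃ j, x j < c * (p.1 * p.2 j)} := by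
  have : {p : ℝ × (κ → ℝ) | ∃ j, x j < c * (p.1 * p.2 j)}
      = ⋃ j, {p | x j < c * (p.1 * p.2 j)} := by ext; simp
  rw [this]
  exact MeasurableSet.iUnion fun j => measurableSet_lt measurable_const (by fun_prop)

lemma lintegral_frechetIntensity_mul (μ : Measure (κ → ℝ)) (x : κ → ℝ) {c : ℝ} (hc : 0 < c) :
    ∫⁻ e, frechetIntensity {z | ∃ j, x j < c * (z * e j)} ∂μ
      = ENNReal.ofReal c * exponent μ x := by
  have hm : Measurable fun e : κ → ℝ => frechetIntensity {z | ∃ j, x j < z * e j} := by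
    have := measurableSet_exists_lt_mul x 1
    simp only [one_mul] at this
    exact measurable_measure_prodMk_right this
  rw [exponent, ← lintegral_const_mul _ hm]
  refine lintegral_congr fun e => ?_
  have hA : MeasurableSet {z : ℝ | ∃ j, x j < z * e j} := by
    have := (measurableSet_exists_lt_mul x 1).preimage
      (f := fun z : ℝ => (z, e)) (by fun_prop)
    simpa using this
  rw [← frechetIntensity_preimage_mul hc hA]
  simp [Set.preimage, mul_assoc]

/-- If the atoms are coloured independently and uniformly with `m` colours, then the atoms of
different colours behave, up to scaling, like independent copies of the point process. -/
lemma IsSpectralRepresentation.measure_coloured_le (h : IsSpectralRepresentation ζ Y P)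
    (m : ℕ) [NeZero m] (x : Fin m → κ → ℝ) :
    (P.prod (colouringLaw m)) {p | ∀ i j, m * atom ζ Y i j p.1 ≤ x (p.2 i) j}
      = ∏ a, expNeg (exponent (spectralLaw Y P) (x a)) := by
  have hm0 : (0 : ℝ) < m := by exact_mod_cast NeZero.pos m
  set B : Fin m → Set (ℝ × (κ → ℝ)) := fun a => {p | ∃ j, x a j < m * (p.1 * p.2 j)} with hB
  have hBm : ∀ a, MeasurableSet (B a) := fun a => measurableSet_exists_lt_mul _ _
  -- The conditional probability, given the atom, that its random colour makes it break the bound of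
  -- that colour.
  let f : ℝ × (κ → ℝ) → ℝ≥0∞ := fun p => colourLaw m {a | p ∈ B a}
  have hfeq : f = fun p => (m : ℝ≥0∞)⁻¹ * ∑ a, (B a).indicator (fun _ => 1) p := by
    ext p
    rw [show f p = colourLaw m {a | p ∈ B a} from rfl, colourLaw_apply]
    congr 1
  have hind : ∀ a, Measurable ((B a).indicator fun _ => (1 : ℝ≥0∞)) := fun a =>
    measurable_const.indicator (hBm a)
  have hf : Measurable f := by
    rw [hfeq]
    exact (Finset.measurable_fun_sum _ fun a _ => hind a).const_mul _
  have : IsProbabilityMeasure (spectralLaw Y P) :=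
    Measure.isProbabilityMeasure_map (h.iid.measurable_path 0).aemeasurable
  have hset : MeasurableSet {p : Ω × (ℕ → Fin m) | ∀ i j, m * atom ζ Y i j p.1 ≤ x (p.2 i) j} := by
    have : {p : Ω × (ℕ → Fin m) | ∀ i j, m * atom ζ Y i j p.1 ≤ x (p.2 i) j}
        = ⋂ i, ⋂ j, {p | m * atom ζ Y i j p.1 ≤ x (p.2 i) j} := by ext; simp
    rw [this]
    refine MeasurableSet.iInter fun i => MeasurableSet.iInter fun j => measurableSet_le
      (((h.measurable_atom i j).comp measurable_fst).const_mul _) ?_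
    exact (Measurable.of_discrete (f := fun a => x a j)).comp
      ((measurable_pi_apply i).comp measurable_snd)
  rw [Measure.prod_apply hset, ← expNeg_sum]
  have hsec : ∀ ω, colouringLaw m (Prod.mk ω ⁻¹'
      {p : Ω × (ℕ → Fin m) | ∀ i j, m * atom ζ Y i j p.1 ≤ x (p.2 i) j})
      = ∏' i, (1 - f (ζ i ω, fun j => Y i j ω)) := fun ω => by
    have : Prod.mk ω ⁻¹' {p : Ω × (ℕ → Fin m) | ∀ i j, m * atom ζ Y i j p.1 ≤ x (p.2 i) j}
        = Set.univ.pi fun i => {a | (ζ i ω, fun j => Y i j ω) ∈ B a}ᶜ := by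
      ext ξ
      simp [hB, atom]
    rw [this, colouringLaw, Measure.infinitePi_pi_univ _ fun i => .of_discrete]
    exact tprod_congr fun i => prob_compl_eq_one_sub .of_discrete
  rw [lintegral_congr hsec, h.poisson.lintegral_tprod_marked h.iid.measurable_path h.iid.indep
    h.iid.map_path h.indep hf fun p => prob_le_one]
  congr 1
  change ∫⁻ z, ∫⁻ e, f (z, e) ∂(spectralLaw Y P) ∂frechetIntensity = _
  rw [lintegral_lintegral_swap hf.aemeasurable, ← lintegral_prod_symm' _ hf, hfeq,
    lintegral_const_mul _ (Finset.measurable_fun_sum _ fun a _ => hind a),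
    lintegral_finsetSum _ fun a _ => hind a, Finset.mul_sum]
  refine Finset.sum_congr rfl fun a _ => ?_
  rw [lintegral_indicator_const (hBm a), one_mul, Measure.prod_apply_symm (hBm a)]
  -- Homogeneity produces a factor `m`, which cancels the weight `1 / m` of one colour.
  have := lintegral_frechetIntensity_mul (spectralLaw Y P) (x a) hm0
  change (m : ℝ≥0∞)⁻¹ * ∫⁻ e, frechetIntensity {z | ∃ j, x a j < m * (z * e j)}
    ∂(spectralLaw Y P) = _
  rw [this, ← mul_assoc, ENNReal.ofReal_natCast, ENNReal.inv_mul_cancel (by simp [NeZero.ne])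
    (by simp), one_mul]

/-- The case of a single colour, in which the colouring is trivial. -/
lemma IsSpectralRepresentation.measure_atom_le (h : IsSpectralRepresentation ζ Y P)
    (x : κ → ℝ) :
    P {ω | ∀ i j, atom ζ Y i j ω ≤ x j} = expNeg (exponent (spectralLaw Y P) x) := by
  have h1 := h.measure_coloured_le 1 fun _ => x
  have h2 : {p : Ω × (ℕ → Fin 1) | ∀ i j, ((1 : ℕ) : ℝ) * atom ζ Y i j p.1 ≤ x j}
      = {ω | ∀ i j, atom ζ Y i j ω ≤ x j} ×ˢ Set.univ := by ext; simp
  rw [h2, Measure.prod_prod] at h1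
  simpa using h1

end Spectral

end Concurrence

/-! ### Coloured maxima as independent copies of `η`; absence of ties -/

namespace Concurrence

open scoped ENNReal NNReal Topology

lemma measure_eq_of_indepFun {Ω : Type*} [MeasurableSpace Ω] {P : Measure Ω}
    [IsProbabilityMeasure P] {X Z : Ω → ℝ} (hX : Measurable X) (hZ : Measurable Z)
    (hind : IndepFun X Z P) (h0 : ∀ c, P {ω | Z ω = c} = 0) : P {ω | X ω = Z ω} = 0 := by
  have hd : MeasurableSet {p : ℝ × ℝ | p.1 = p.2} := measurableSet_eq_fun measurable_fst
    measurable_snd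
  have : IsProbabilityMeasure (P.map X) := Measure.isProbabilityMeasure_map hX.aemeasurable
  have : IsProbabilityMeasure (P.map Z) := Measure.isProbabilityMeasure_map hZ.aemeasurable
  change P ((fun ω => (X ω, Z ω)) ⁻¹' {p : ℝ × ℝ | p.1 = p.2}) = 0
  rw [← Measure.map_apply (hX.prodMk hZ) hd,
    (indepFun_iff_map_prod_eq_prod_map_map hX.aemeasurable hZ.aemeasurable).1 hind,
    Measure.prod_apply hd]
  refine (lintegral_congr fun x => ?_).trans lintegral_zero
  have : Prod.mk x ⁻¹' {p : ℝ × ℝ | p.1 = p.2} = {x} := by ext; simp [eq_comm]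
  rw [this, Measure.map_apply hZ (measurableSet_singleton x)]
  exact h0 x

/-- A probability measure on a product of spaces `κ → ℝ` is a product measure if its
distribution function factorises. -/
lemma pi_eq_of_Iic {ι κ : Type*} [Fintype ι] [Finite κ] {μ : Measure (κ → ℝ)}
    [IsProbabilityMeasure μ] {ρ : Measure (ι → κ → ℝ)}
    (h : ∀ x : ι → κ → ℝ, ρ {v | ∀ a, v a ≤ x a} = ∏ a, μ (Set.Iic (x a))) :
    Measure.pi (fun _ => μ) = ρ := by
  have hrep : ∀ s ∈ Set.pi Set.univ '' Set.pi Set.univ (fun _ : κ => Set.range (Set.Iic (α := ℝ))),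
      ∃ x : κ → ℝ, s = Set.Iic x := by
    rintro _ ⟨t, ht, rfl⟩
    choose x hx using fun j => ht j (Set.mem_univ j)
    exact ⟨x, by rw [← Set.pi_univ_Iic]; simp only [hx]⟩
  have hspan : ∀ n : ℕ, Set.Iic (fun _ : κ => (n : ℝ)) ∈
      Set.pi Set.univ '' Set.pi Set.univ (fun _ : κ => Set.range (Set.Iic (α := ℝ))) := fun n =>
    ⟨fun _ => Set.Iic (n : ℝ), fun _ _ => ⟨n, rfl⟩, Set.pi_univ_Iic _⟩
  refine Measure.pi_eq_generateFrom
    (C := fun _ => Set.pi Set.univ '' Set.pi Set.univ fun _ => Set.range (Set.Iic (α := ℝ)))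
    (fun _ => ?_) (fun _ => ?_) (fun _ => ?_) fun s hs => ?_
  · refine generateFrom_eq_pi (fun _ => ?_) fun _ => ?_
    · rw [← borel_eq_generateFrom_Iic]
      exact (BorelSpace.measurable_eq (α := ℝ)).symm
    · refine ⟨fun n : ℕ => Set.Iic (n : ℝ), fun n => ⟨n, rfl⟩, ?_⟩
      exact Set.eq_univ_of_forall fun x => Set.mem_iUnion.2 (exists_nat_ge x)
  · exact IsPiSystem.pi fun _ => isPiSystem_Iic
  · exact ⟨fun n => Set.Iic fun _ => (n : ℝ), hspan, fun n => measure_lt_top _ _,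
      Set.eq_univ_of_forall fun x => Set.mem_iUnion.2 (by
        obtain ⟨M, hM⟩ := (Set.finite_range x).bddAbove
        obtain ⟨n, hn⟩ := exists_nat_ge M
        exact ⟨n, fun j => (hM ⟨j, rfl⟩).trans hn⟩)⟩
  · choose x hx using fun a => hrep _ (hs a)
    simp_rw [hx, ← h x]
    congr 1
    ext v
    simp [hx]

/-- The maximum of the atoms of colour `a`, scaled by the number of colours. -/
noncomputable def colouredMax {Ω κ : Type*} (ζ : ℕ → Ω → ℝ) (Y : ℕ → κ → Ω → ℝ) (m : ℕ)
    (a : Fin m) (j : κ) (p : Ω × (ℕ → Fin m)) : ℝ :=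
  ⨆ i, if p.2 i = a then m * atom ζ Y i j p.1 else 0

/-- The value `0` given to atoms of other colours is harmless because atoms are non-negative. -/
lemma colouredMax_le {Ω κ : Type*} {ζ : ℕ → Ω → ℝ} {Y : ℕ → κ → Ω → ℝ}
    {m : ℕ} {j : κ} {ω : Ω} (hnn : ∀ i, 0 ≤ atom ζ Y i j ω) {i : ℕ}
    (hi : i ∈ argMax ζ Y j ω) (ξ : ℕ → Fin m) (a : Fin m) :
    colouredMax ζ Y m a j (ω, ξ) ≤ m * atom ζ Y i j ω := by
  refine ciSup_le fun l => ?_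
  dsimp only
  split_ifs
  · exact mul_le_mul_of_nonneg_left (hi l) (Nat.cast_nonneg m)
  · exact mul_nonneg (Nat.cast_nonneg m) (hnn i)

lemma colouredMax_eq {Ω κ : Type*} {ζ : ℕ → Ω → ℝ} {Y : ℕ → κ → Ω → ℝ}
    {m : ℕ} {j : κ} {ω : Ω} (hnn : ∀ i, 0 ≤ atom ζ Y i j ω) {i : ℕ}
    (hi : i ∈ argMax ζ Y j ω) (ξ : ℕ → Fin m) :
    colouredMax ζ Y m (ξ i) j (ω, ξ) = m * atom ζ Y i j ω := by
  refine le_antisymm (colouredMax_le hnn hi ξ _) ?_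
  have hb : BddAbove (Set.range fun l => if ξ l = ξ i then m * atom ζ Y l j ω else 0) := by
    refine ⟨m * atom ζ Y i j ω, ?_⟩
    rintro _ ⟨l, rfl⟩
    dsimp only
    split_ifs
    · exact mul_le_mul_of_nonneg_left (hi l) (Nat.cast_nonneg m)
    · exact mul_nonneg (Nat.cast_nonneg m) (hnn i)
  simpa [colouredMax] using le_ciSup hb i

section Spectral

variable {Ω κ : Type*} [MeasurableSpace Ω] {ζ : ℕ → Ω → ℝ} {Y : ℕ → κ → Ω → ℝ}
  {P : Measure Ω}

lemma IsSpectralRepresentation.measurable_colouredMax (h : IsSpectralRepresentation ζ Y P)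
    (m : ℕ) (a : Fin m) (j : κ) : Measurable (colouredMax ζ Y m a j) := by
  have hi : ∀ i, Measurable fun p : Ω × (ℕ → Fin m) => p.2 i := fun i => by fun_prop
  exact Measurable.iSup fun i => Measurable.ite (hi i (measurableSet_singleton a))
    (((h.measurable_atom i j).comp measurable_fst).const_mul _) measurable_const

/-- The law of the simple max-stable process. -/
noncomputable def simpleMaxLaw (ζ : ℕ → Ω → ℝ) (Y : ℕ → κ → Ω → ℝ) (P : Measure Ω) :
    Measure (κ → ℝ) :=
  P.map fun ω j => simpleMaxStable ζ Y j ω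

lemma IsSpectralRepresentation.measurable_simpleMax_path (h : IsSpectralRepresentation ζ Y P) :
    Measurable fun ω j => simpleMaxStable ζ Y j ω :=
  measurable_pi_lambda _ fun j => h.measurable_simpleMaxStable j

variable [IsProbabilityMeasure P]

lemma IsSpectralRepresentation.simpleMaxLaw_Iic [Countable κ]
    (h : IsSpectralRepresentation ζ Y P) (x : κ → ℝ) :
    simpleMaxLaw ζ Y P (Set.Iic x) = expNeg (exponent (spectralLaw Y P) x) := by
  have hm : MeasurableSet (Set.Iic x) := by
    rw [← Set.pi_univ_Iic]
    exact MeasurableSet.univ_pi fun _ => measurableSet_Iic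
  rw [simpleMaxLaw, Measure.map_apply h.measurable_simpleMax_path hm, ← h.measure_atom_le]
  refine measure_congr ?_
  -- Boundedness excludes the default value `0` of an unbounded real supremum.
  filter_upwards [ae_all_iff.2 h.ae_bddAbove] with ω hω
  refine propext ⟨fun hx i j => (le_ciSup (hω j) i).trans (hx j),
    fun hx j => ciSup_le fun i => hx i j⟩

/-- The margins of the simple max-stable process are standard Fréchet. -/
lemma IsSpectralRepresentation.measure_simpleMax_le (h : IsSpectralRepresentation ζ Y P) (j : κ)
    {t : ℝ} (ht : 0 < t) :
    P {ω | simpleMaxStable ζ Y j ω ≤ t} = ENNReal.ofReal (Real.exp (-t⁻¹)) := by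
  have h1 := (h.reindex fun _ : Unit => j).measure_atom_le fun _ => t
  have h2 := (h.reindex fun _ : Unit => j).lintegral_frechetIntensity () ht
  have h3 : ∀ e : Unit → ℝ, {z | ∃ u, t < z * e u} = {z | t < z * e ()} := fun e => by
    ext z
    exact ⟨fun ⟨_, hu⟩ => hu, fun hz => ⟨(), hz⟩⟩
  rw [exponent, lintegral_congr fun e => congrArg frechetIntensity (h3 e), h2,
    ENNReal.ofReal, expNeg_coe, Real.coe_toNNReal _ (inv_nonneg.2 ht.le)] at h1
  rw [← h1]
  refine measure_congr ?_
  filter_upwards [h.ae_bddAbove j] with ω hω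
  refine propext ⟨fun hx i _ => (le_ciSup hω i).trans hx, fun hx => ciSup_le fun i => hx i ()⟩

lemma IsSpectralRepresentation.measure_simpleMax_nonpos (h : IsSpectralRepresentation ζ Y P)
    (j : κ) : P {ω | simpleMaxStable ζ Y j ω ≤ 0} = 0 := by
  have h1 : Tendsto (fun t : ℝ => ENNReal.ofReal (Real.exp (-t⁻¹))) (𝓝[>] 0) (𝓝 0) := by
    rw [← ENNReal.ofReal_zero]
    exact ENNReal.tendsto_ofReal (Real.tendsto_exp_atBot.comp
      (tendsto_neg_atTop_atBot.comp tendsto_inv_nhdsGT_zero))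
  refine le_antisymm (ge_of_tendsto h1 ?_) zero_le
  filter_upwards [self_mem_nhdsWithin] with t ht
  rw [← h.measure_simpleMax_le j ht]
  exact measure_mono fun ω (hω : simpleMaxStable ζ Y j ω ≤ 0) => hω.trans (le_of_lt ht)

/-- For `c > 0` the event lies in `{t < η ≤ c}` for every `t < c`, and the Fréchet distribution
function is continuous at `c`. -/
lemma IsSpectralRepresentation.measure_simpleMax_eq (h : IsSpectralRepresentation ζ Y P)
    (j : κ) (c : ℝ) : P {ω | simpleMaxStable ζ Y j ω = c} = 0 := by
  rcases le_or_gt c 0 with hc | hc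
  · exact measure_mono_null (fun ω (hω : _ = c) => hω.le.trans hc) (h.measure_simpleMax_nonpos j)
  have h1 : Tendsto (fun t : ℝ => ENNReal.ofReal (Real.exp (-c⁻¹) - Real.exp (-t⁻¹)))
      (𝓝[<] c) (𝓝 0) := by
    have h2 : ContinuousAt (fun t : ℝ => Real.exp (-c⁻¹) - Real.exp (-t⁻¹)) c :=
      continuousAt_const.sub (Real.continuous_exp.continuousAt.comp (continuousAt_inv₀ hc.ne').neg)
    have h3 := ENNReal.tendsto_ofReal (h2.tendsto.mono_left (nhdsWithin_le_nhds (s := Set.Iio c)))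
    simpa using h3
  refine le_antisymm (ge_of_tendsto h1 ?_) zero_le
  filter_upwards [Ioo_mem_nhdsLT hc] with t ht
  rw [ENNReal.ofReal_sub _ (Real.exp_pos _).le, ← h.measure_simpleMax_le j hc,
    ← h.measure_simpleMax_le j ht.1]
  refine ENNReal.le_sub_of_add_le_right (measure_ne_top _ _) ?_
  rw [← measure_union _ (measurableSet_le (h.measurable_simpleMaxStable j) measurable_const)]
  · refine measure_mono ?_
    rintro ω (hω | hω)
    · exact le_of_eq hω
    · exact le_trans hω ht.2.le
  · refine Set.disjoint_left.2 fun ω (hω : _ = c) (hω' : _ ≤ t) => ?_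
    exact absurd (hω ▸ hω') (not_le.2 ht.2)

/-- By `measure_coloured_le` the joint distribution function is a product over colours, and each
factor is the distribution function of `η`. -/
lemma IsSpectralRepresentation.map_colouredMax [Finite κ] (h : IsSpectralRepresentation ζ Y P)
    (m : ℕ) [NeZero m] :
    (P.prod (colouringLaw m)).map (fun p a j => colouredMax ζ Y m a j p)
      = Measure.pi fun _ => simpleMaxLaw ζ Y P := by
  have : IsProbabilityMeasure (simpleMaxLaw ζ Y P) :=
    Measure.isProbabilityMeasure_map h.measurable_simpleMax_path.aemeasurable
  have hm : Measurable fun p a j => colouredMax ζ Y m a j p :=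
    measurable_pi_lambda _ fun a => measurable_pi_lambda _ fun j => h.measurable_colouredMax m a j
  refine (pi_eq_of_Iic fun x => ?_).symm
  have hset : MeasurableSet {v : Fin m → κ → ℝ | ∀ a, v a ≤ x a} := by
    have : {v : Fin m → κ → ℝ | ∀ a, v a ≤ x a}
        = ⋂ a, ⋂ j, {v | v a j ≤ x a j} := by ext; simp [Pi.le_def]
    rw [this]
    exact MeasurableSet.iInter fun a => MeasurableSet.iInter fun j =>
      measurableSet_le (by fun_prop) measurable_const
  rw [Measure.map_apply hm hset]
  have hae : ∀ᵐ p ∂(P.prod (colouringLaw m)), ∀ j,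
      BddAbove (Set.range fun i => atom ζ Y i j p.1) ∧ ∀ i, 0 ≤ atom ζ Y i j p.1 :=
    Measure.quasiMeasurePreserving_fst.ae (ae_all_iff.2 fun j =>
      (h.ae_bddAbove j).and (h.ae_atom_nonneg j))
  by_cases hx : ∀ a j, 0 ≤ x a j
  · simp_rw [h.simpleMaxLaw_Iic, ← h.measure_coloured_le]
    refine measure_congr ?_
    filter_upwards [hae] with p hp
    refine propext ⟨fun hle i j => ?_, fun hle a j => ciSup_le fun i => ?_⟩
    · refine le_trans ?_ (hle (p.2 i) j)
      obtain ⟨M, hM⟩ := (hp j).1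
      have hb : BddAbove (Set.range fun l =>
          if p.2 l = p.2 i then m * atom ζ Y l j p.1 else 0) := by
        refine ⟨m * M, ?_⟩
        rintro _ ⟨l, rfl⟩
        dsimp only
        have hl : m * atom ζ Y l j p.1 ≤ m * M :=
          mul_le_mul_of_nonneg_left (hM ⟨l, rfl⟩) (Nat.cast_nonneg m)
        split_ifs
        · exact hl
        · exact le_trans (mul_nonneg (Nat.cast_nonneg m) ((hp j).2 l)) hl
      simpa [colouredMax] using le_ciSup hb i
    · dsimp only
      split_ifs with hi
      · exact hi ▸ hle i j
      · exact hx a j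
  -- If some threshold is negative, both sides vanish: coloured maxima are almost surely
  -- non-negative, and `η` is almost surely positive.
  · push Not at hx
    obtain ⟨a, j, haj⟩ := hx
    rw [Finset.prod_eq_zero (Finset.mem_univ a)]
    · refine measure_mono_null_ae ?_ (measure_empty (μ := P.prod (colouringLaw m)))
      filter_upwards [hae] with p hp hle
      refine absurd (hle a j) (not_le.2 (haj.trans_le (Real.iSup_nonneg fun i => ?_)))
      split_ifs
      · exact mul_nonneg (Nat.cast_nonneg m) ((hp j).2 i)
      · exact le_rfl
    · rw [simpleMaxLaw, Measure.map_apply h.measurable_simpleMax_path (by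
        rw [← Set.pi_univ_Iic]
        exact MeasurableSet.univ_pi fun _ => measurableSet_Iic)]
      exact measure_mono_null (fun ω hω => (hω j).trans haj.le) (h.measure_simpleMax_nonpos j)

/-- Different colours give independent variables with atomless laws at each site. -/
lemma IsSpectralRepresentation.ae_colouredMax_ne [Finite κ] (h : IsSpectralRepresentation ζ Y P)
    (m : ℕ) [NeZero m] :
    ∀ᵐ p ∂(P.prod (colouringLaw m)), ∀ a b, a ≠ b → ∀ j,
      colouredMax ζ Y m a j p ≠ colouredMax ζ Y m b j p := by
  have : IsProbabilityMeasure (simpleMaxLaw ζ Y P) :=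
    Measure.isProbabilityMeasure_map h.measurable_simpleMax_path.aemeasurable
  have hm : Measurable fun p a j => colouredMax ζ Y m a j p :=
    measurable_pi_lambda _ fun a => measurable_pi_lambda _ fun j => h.measurable_colouredMax m a j
  have hkey : ∀ᵐ v ∂(Measure.pi fun _ : Fin m => simpleMaxLaw ζ Y P), ∀ a b, a ≠ b → ∀ j,
      v a j ≠ v b j := by
    refine ae_all_iff.2 fun a => ae_all_iff.2 fun b => ae_all_iff.2 fun hab =>
      ae_all_iff.2 fun j => ?_
    have hi := iIndepFun_pi (μ := fun _ : Fin m => simpleMaxLaw ζ Y P)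
      (X := fun _ (v : κ → ℝ) => v j) fun _ => (measurable_pi_apply j).aemeasurable
    rw [ae_iff]
    simp only [not_not]
    refine measure_eq_of_indepFun (by fun_prop) (by fun_prop) (hi.indepFun hab) fun c => ?_
    have := (measurePreserving_eval (fun _ : Fin m => simpleMaxLaw ζ Y P) b).measure_preimage
      (s := {v : κ → ℝ | v j = c})
      (measurableSet_eq_fun (measurable_pi_apply j) measurable_const).nullMeasurableSet
    refine this.trans ?_
    rw [simpleMaxLaw, Measure.map_apply h.measurable_simpleMax_path
      (measurableSet_eq_fun (measurable_pi_apply j) measurable_const)]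
    exact h.measure_simpleMax_eq j c
  rw [← h.map_colouredMax m] at hkey
  exact ae_of_ae_map hm.aemeasurable hkey

/-- Almost surely the maximum at a site is attained by exactly one atom. -/
lemma IsSpectralRepresentation.ae_argMax (h : IsSpectralRepresentation ζ Y P) (j : κ) :
    ∀ᵐ ω ∂P, ∃ i, argMax ζ Y j ω = {i} := by
  -- Two colours suffice to detect a tie between atoms at one site.
  have hties := Measure.ae_ae_of_ae_prod ((h.reindex fun _ : Unit => j).ae_colouredMax_ne 2)
  have hpos : ∀ᵐ ω ∂P, ¬ simpleMaxStable ζ Y j ω ≤ 0 := by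
    rw [ae_iff]
    simpa using h.measure_simpleMax_nonpos j
  filter_upwards [hties, hpos, h.ae_finite j, h.ae_atom_nonneg j] with ω hne hp hfin hnn
  have hex : ∃ i, 0 < atom ζ Y i j ω := by
    by_contra! hcon
    exact hp (ciSup_le hcon)
  obtain ⟨i₀, hi₀⟩ := hex
  -- Only finitely many atoms exceed half of a given positive atom, so a largest one exists.
  obtain ⟨i, hi, himax⟩ := Set.exists_max_image _ (fun i => atom ζ Y i j ω)
    (hfin (atom ζ Y i₀ j ω / 2) (by positivity)) ⟨i₀, half_lt_self hi₀⟩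
  have hiarg : i ∈ argMax ζ Y j ω := fun l => by
    by_cases hl : atom ζ Y i₀ j ω / 2 < atom ζ Y l j ω
    · exact himax l hl
    · exact (not_lt.1 hl).trans (le_of_lt hi)
  refine ⟨i, Set.eq_singleton_iff_unique_mem.2 ⟨hiarg, fun l hl => ?_⟩⟩
  by_contra hli
  -- If `i` and `l` both attained the maximum, they would receive the colours 0 and 1 with positive
  -- probability. The two coloured maxima would then coincide, against `hne`.
  have hmeas : colouringLaw 2 (Set.pi ({i, l} : Finset ℕ)
      fun n => ({if n = i then 0 else 1} : Set (Fin 2))) ≠ 0 := by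
    rw [colouringLaw, Measure.infinitePi_pi _ fun n _ => .of_discrete]
    exact Finset.prod_ne_zero_iff.2 fun n _ => by simp [colourLaw_singleton]
  refine hmeas (measure_mono_null (fun ξ hξ => ?_) (ae_iff.1 hne))
  have h0 : ξ i = 0 := by simpa using hξ i (by simp)
  have h1 : ξ l = 1 := by simpa [hli] using hξ l (by simp)
  simp only [Set.mem_ofPred_eq, not_forall, not_not]
  refine ⟨0, 1, by simp, (), ?_⟩
  have e0 := colouredMax_eq (ζ := ζ) (Y := fun i (_ : Unit) => Y i j) (j := ()) hnn hiarg ξ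
  have e1 := colouredMax_eq (ζ := ζ) (Y := fun i (_ : Unit) => Y i j) (j := ()) hnn hl ξ
  rw [h0] at e0
  rw [h1] at e1
  rw [e0, e1]
  congr 1
  exact le_antisymm (hl i) (hiarg l)

end Spectral

end Concurrence

/-! ### Hitting scenarios and the concurrence probability of the coloured sample -/

namespace Concurrence

open scoped ENNReal NNReal Topology

/-- There are `m` mutually exclusive choices of the common colour, each prescribing one colour at
every distinct index. Exclusivity needs `κ` nonempty. -/
lemma colouringLaw_constant {κ : Type*} [Fintype κ] [Nonempty κ] (m : ℕ) [NeZero m] (i : κ → ℕ) :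
    colouringLaw m {ξ | ∃ a, ∀ j, ξ (i j) = a}
      = m * ((m : ℝ≥0∞)⁻¹) ^ (Finset.univ.image i).card := by
  have hpi : ∀ a : Fin m, {ξ : ℕ → Fin m | ∀ j, ξ (i j) = a}
      = Set.pi (Finset.univ.image i : Finset ℕ) fun _ => {a} := fun a => by
    ext ξ
    simp
  have hm : ∀ a : Fin m, MeasurableSet {ξ : ℕ → Fin m | ∀ j, ξ (i j) = a} := fun a => by
    rw [hpi a]
    exact .pi (Finset.countable_toSet _) fun _ _ => .of_discrete
  have hU : {ξ : ℕ → Fin m | ∃ a, ∀ j, ξ (i j) = a} = ⋃ a, {ξ | ∀ j, ξ (i j) = a} := by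
    ext ξ
    simp
  have hd : Pairwise (Function.onFun Disjoint
      fun a : Fin m => {ξ : ℕ → Fin m | ∀ j, ξ (i j) = a}) := fun a b hab =>
    Set.disjoint_left.2 fun ξ (ha : ∀ j, ξ (i j) = a) (hb : ∀ j, ξ (i j) = b) =>
      hab ((ha (Classical.arbitrary κ)).symm.trans (hb (Classical.arbitrary κ)))
  rw [hU, measure_iUnion hd hm, tsum_fintype]
  have : ∀ a : Fin m, colouringLaw m {ξ | ∀ j, ξ (i j) = a}
      = ((m : ℝ≥0∞)⁻¹) ^ (Finset.univ.image i).card := fun a => by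
    rw [hpi a, colouringLaw, Measure.infinitePi_pi _ fun n _ => .of_discrete]
    simp [colourLaw_singleton]
  simp [this]

variable {Ω : Type*} {k : ℕ} {ζ : ℕ → Ω → ℝ} {Y : ℕ → Fin k → Ω → ℝ}

lemma numBlocks_eq_card {ω : Ω} {i : Fin k → ℕ} (hi : ∀ j, argMax ζ Y j ω = {i j}) :
    numBlocks ζ Y id ω = (Finset.univ.image i).card := by
  have hf : (fun j : Fin k => argMax ζ Y (id j) ω) = fun j => {i j} := funext hi
  have h1 : Set.range (fun j => ({i j} : Set ℕ)) = singleton '' Set.range i := by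
    rw [← Set.range_comp]
    rfl
  rw [numBlocks, hittingScenario, hf, ← Nat.card_coe_set_eq,
    Nat.card_congr ((Setoid.quotientEquivClasses _).symm.trans (Setoid.quotientKerEquivRange _)),
    Nat.card_coe_set_eq, h1, Set.ncard_image_of_injective _ Set.singleton_injective,
    ← Set.ncard_coe_finset]
  simp

lemma eq_simpleMaxStable_iff {j : Fin k} {ω : Ω}
    (hb : BddAbove (Set.range fun i => atom ζ Y i j ω)) (l : ℕ) :
    simpleMaxStable ζ Y j ω = atom ζ Y l j ω ↔ l ∈ argMax ζ Y j ω :=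
  ⟨fun h i => (le_ciSup hb i).trans h.le, fun h => le_antisymm (ciSup_le h) (le_ciSup hb l)⟩

variable [MeasurableSpace Ω] {P : Measure Ω}

/-- The number of blocks is a function of the relation on `Fin k`, which takes finitely many values
and is determined by countably many comparisons of atoms. -/
lemma IsSpectralRepresentation.measurable_numBlocks (h : IsSpectralRepresentation ζ Y P) :
    Measurable (numBlocks ζ Y id) := by
  have harg : ∀ i j, MeasurableSet {ω | i ∈ argMax ζ Y j ω} := fun i j => by
    have : {ω | i ∈ argMax ζ Y j ω} = ⋂ l, {ω | atom ζ Y l j ω ≤ atom ζ Y i j ω} := by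
      ext ω
      simp [argMax]
    rw [this]
    exact MeasurableSet.iInter fun l =>
      measurableSet_le (h.measurable_atom l j) (h.measurable_atom i j)
  have hrel : Measurable fun ω (j₁ j₂ : Fin k) => argMax ζ Y j₁ ω = argMax ζ Y j₂ ω := by
    refine measurable_pi_lambda _ fun j₁ => measurable_pi_lambda _ fun j₂ =>
      measurableSet_setOfPred.1 ?_
    have : {ω | argMax ζ Y j₁ ω = argMax ζ Y j₂ ω}
        = ⋂ i, {ω | i ∈ argMax ζ Y j₁ ω ↔ i ∈ argMax ζ Y j₂ ω} := by
      ext ω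
      simp [Set.ext_iff]
    rw [this]
    exact MeasurableSet.iInter fun i =>
      measurableSet_setOfPred.2 ((measurableSet_setOfPred.1 (harg i j₁)).iff
        (measurableSet_setOfPred.1 (harg i j₂)))
  exact (Measurable.of_discrete (f := fun r : Fin k → Fin k → Prop =>
    Set.ncard {s | ∃ y, s = {x | r x y}})).comp hrel

variable [IsProbabilityMeasure P]

lemma IsSpectralRepresentation.ae_numBlocks (h : IsSpectralRepresentation ζ Y P) [NeZero k] :
    ∀ᵐ ω ∂P, numBlocks ζ Y id ω ∈ Finset.Icc 1 k := by
  filter_upwards [ae_all_iff.2 h.ae_argMax] with ω hω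
  choose i hi using hω
  rw [numBlocks_eq_card hi, Finset.mem_Icc]
  refine ⟨Finset.card_pos.2 (Finset.univ_nonempty.image i), ?_⟩
  simpa using Finset.card_image_le (s := Finset.univ) (f := i)

lemma IsSpectralRepresentation.lintegral_numBlocks (h : IsSpectralRepresentation ζ Y P) [NeZero k]
    (g : ℕ → ℝ≥0∞) :
    ∫⁻ ω, g (numBlocks ζ Y id ω) ∂P
      = ∑ l ∈ Finset.Icc 1 k, g l * P {ω | numBlocks ζ Y id ω = l} := by
  have hm : ∀ l, MeasurableSet {ω | numBlocks ζ Y id ω = l} := fun l =>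
    h.measurable_numBlocks (measurableSet_singleton l)
  have : ∀ᵐ ω ∂P, g (numBlocks ζ Y id ω)
      = ∑ l ∈ Finset.Icc 1 k, {ω | numBlocks ζ Y id ω = l}.indicator (fun _ => g l) ω := by
    filter_upwards [h.ae_numBlocks] with ω hω
    refine Eq.symm ((Finset.sum_eq_single_of_mem (numBlocks ζ Y id ω) hω fun l _ hl => ?_).trans
      (Set.indicator_of_mem rfl _))
    exact Set.indicator_of_notMem (fun h' => hl (Eq.symm h')) _
  rw [lintegral_congr_ae this, lintegral_finsetSum _ fun l _ => measurable_const.indicator (hm l)]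
  exact Finset.sum_congr rfl fun l _ => lintegral_indicator_const (hm l) _

/-- The samples in which a single observation attains the maximum at all sites. -/
def concurrenceSet (m k : ℕ) : Set (Fin m → Fin k → ℝ) := {v | ∃ l, ∀ j i, v i j ≤ v l j}

lemma measurableSet_concurrenceSet (m k : ℕ) : MeasurableSet (concurrenceSet m k) := by
  have : concurrenceSet m k = ⋃ l, ⋂ j, ⋂ i, {v | v i j ≤ v l j} := by
    ext v
    simp [concurrenceSet]
  rw [this]
  exact MeasurableSet.iUnion fun l => MeasurableSet.iInter fun j => MeasurableSet.iInter fun i =>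
    measurableSet_le (by fun_prop) (by fun_prop)

/-- The probability of concurrence in a sample from the simple max-stable law. -/
lemma IsSpectralRepresentation.pi_concurrenceSet (h : IsSpectralRepresentation ζ Y P) [NeZero k]
    (m : ℕ) [NeZero m] :
    (Measure.pi fun _ => simpleMaxLaw ζ Y P) (concurrenceSet m k)
      = ∑ l ∈ Finset.Icc 1 k,
        (m * ((m : ℝ≥0∞)⁻¹) ^ l) * P {ω | numBlocks ζ Y id ω = l} := by
  have hm : Measurable fun p a j => colouredMax ζ Y m a j p :=
    measurable_pi_lambda _ fun a => measurable_pi_lambda _ fun j => h.measurable_colouredMax m a j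
  have hC := measurableSet_concurrenceSet m k
  rw [← h.lintegral_numBlocks fun l => m * ((m : ℝ≥0∞)⁻¹) ^ l, ← h.map_colouredMax m,
    Measure.map_apply hm hC, Measure.prod_apply (hm hC)]
  refine lintegral_congr_ae ?_
  filter_upwards [ae_all_iff.2 h.ae_argMax, ae_all_iff.2 h.ae_atom_nonneg,
    Measure.ae_ae_of_ae_prod (h.ae_colouredMax_ne m)] with ω harg hnn hne
  choose i hi using harg
  have himem : ∀ j, i j ∈ argMax ζ Y j ω := fun j => hi j ▸ rfl
  rw [numBlocks_eq_card hi, ← colouringLaw_constant]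
  refine measure_congr ?_
  filter_upwards [hne] with ξ hξ
  refine propext ⟨fun ⟨a, ha⟩ => ⟨a, fun j => ?_⟩, fun ⟨a, ha⟩ => ⟨a, fun j b => ?_⟩⟩
  -- If the maximal atom at site `j` had a colour other than `a`, the maxima of these two colours
  -- would tie there.
  · by_contra hja
    refine hξ _ _ hja j (le_antisymm (ha j _) ?_)
    rw [colouredMax_eq (hnn j) (himem j)]
    exact colouredMax_le (hnn j) (himem j) ξ a
  · dsimp only
    rw [← ha j, colouredMax_eq (hnn j) (himem j)]
    exact colouredMax_le (hnn j) (himem j) ξ b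

/-- With unique maximisers, one atom attains `η` at all sites exactly when `π` has a single block.
-/
lemma IsSpectralRepresentation.extremalConcurrenceProb_eq (h : IsSpectralRepresentation ζ Y P)
    [NeZero k] :
    extremalConcurrenceProb ζ Y P id = P.real {ω | numBlocks ζ Y id ω = 1} := by
  refine measureReal_congr ?_
  filter_upwards [ae_all_iff.2 h.ae_argMax, ae_all_iff.2 h.ae_bddAbove] with ω harg hb
  choose i hi using harg
  have h1 : (∃ l, ∀ j, simpleMaxStable ζ Y (id j) ω = atom ζ Y l (id j) ω) ↔
      ∃ l, ∀ j, l = i j := by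
    simp_rw [eq_simpleMaxStable_iff (hb _), id, hi, Set.mem_singleton_iff]
  refine propext (h1.trans ?_)
  change _ ↔ numBlocks ζ Y id ω = 1
  rw [numBlocks_eq_card hi, Finset.card_eq_one]
  refine exists_congr fun l => ⟨fun hl => ?_, fun hl j => ?_⟩
  · rw [show i = fun _ => l from funext fun j => (hl j).symm]
    exact Finset.image_const Finset.univ_nonempty l
  · exact (Finset.mem_singleton.1 (hl ▸ Finset.mem_image_of_mem i (Finset.mem_univ j))).symm

end Concurrence

/-! ### Standardising the margins of the sample -/

namespace Concurrence

open scoped ENNReal NNReal Topology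

/-- Off `A` the transformation is arbitrary and need not be measurable, so it is replaced by `0`
there. -/
lemma measurable_indicator_of_strictMonoOn {A : Set ℝ} {h : ℝ → ℝ} (hA : MeasurableSet A)
    (hh : StrictMonoOn h A) : Measurable (A.indicator h) := by
  have h1 : Monotone (A.domRestrict h) := fun x y hxy => hh.monotoneOn x.2 y.2 hxy
  refine measurable_of_restrict_of_restrict_compl hA ?_ ?_
  · convert! h1.measurable using 1
    exact funext fun x => Set.indicator_of_mem x.2 h
  · convert! measurable_const (a := (0 : ℝ)) using 1
    exact funext fun x => Set.indicator_of_notMem x.2 h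

/-- The sample concurrence probability depends only on the law of the standardised sample. -/
lemma sampleConcurrenceProb_eq {S Ω Ω' : Type*} [MeasurableSpace Ω] [MeasurableSpace Ω']
    {P : Measure Ω} [IsProbabilityMeasure P] {P' : Measure Ω'}
    {X : ℕ → S → Ω → ℝ} (hX : IsIIDCopies X P) {ζ : ℕ → Ω' → ℝ} {Y : ℕ → S → Ω' → ℝ}
    (hmax : IsMaxStable (X 0) P ζ Y P') {k : ℕ} (s : Fin k → S) (m : ℕ) :
    sampleConcurrenceProb X P s m
      = (Measure.pi fun _ => simpleMaxLaw ζ (fun i j => Y i (s j)) P').real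
        (concurrenceSet m k) := by
  obtain ⟨A, h, hA, hlaw⟩ := hmax.identDistrib
  let u : (S → ℝ) → Fin k → ℝ := fun f j => (A (s j)).indicator (h (s j)) (f (s j))
  have hu : Measurable u := measurable_pi_lambda _ fun j =>
    (measurable_indicator_of_strictMonoOn (hA (s j)).1 (hA (s j)).2.2).comp
      (measurable_pi_apply (s j))
  have hXm : ∀ i, Measurable fun ω x => X i x ω := fun i =>
    measurable_pi_lambda _ (hX.measurable i)
  have hmem : ∀ i, ∀ᵐ ω ∂P, ∀ j, X i (s j) ω ∈ A (s j) := fun i => ae_all_iff.2 fun j =>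
    ((hX.identDistrib i).comp (measurable_pi_apply (s j))).symm.ae_mem_snd
      (t := A (s j)) (hA (s j)).1 (hA (s j)).2.1
  have hlaw0 : ∀ i, P.map (u ∘ fun ω x => X i x ω)
      = simpleMaxLaw ζ (fun i j => Y i (s j)) P' := fun i => by
    rw [((hX.identDistrib i).comp hu).map_eq]
    refine Eq.trans (Measure.map_congr ?_) (hlaw k s).map_eq
    filter_upwards [hmem 0] with ω hω
    exact funext fun j => Set.indicator_of_mem (hω j) _
  have hpi : P.map (fun ω (i : Fin m) => (u ∘ fun ω x => X i x ω) ω)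
      = Measure.pi fun _ => simpleMaxLaw ζ (fun i j => Y i (s j)) P' := by
    rw [(iIndepFun_iff_map_fun_eq_pi_map fun i : Fin m => (hu.comp (hXm i)).aemeasurable).1
      ((hX.indep.comp (fun _ => u) fun _ => hu).precomp Fin.val_injective)]
    congr 1
    exact funext fun i => hlaw0 i
  rw [← hpi, measureReal_def, Measure.map_apply
    (measurable_pi_lambda _ fun i : Fin m => hu.comp (hXm i)) (measurableSet_concurrenceSet m k),
    ← measureReal_def]
  refine measureReal_congr ?_
  filter_upwards [ae_all_iff.2 hmem] with ω hω
  -- On `A` the strictly increasing map preserves and reflects order, so the original and the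
  -- standardised samples concur together.
  have hle : ∀ i l j, u (fun x => X i x ω) j ≤ u (fun x => X l x ω) j ↔
      X i (s j) ω ≤ X l (s j) ω := fun i l j => by
    simp only [u]
    rw [Set.indicator_of_mem (hω i j), Set.indicator_of_mem (hω l j)]
    exact (hA (s j)).2.2.le_iff_le (hω i j) (hω l j)
  refine propext ⟨fun ⟨l, hl, hmx⟩ => ⟨⟨l, hl⟩, fun j i => ?_⟩, fun ⟨l, hmx⟩ =>
    ⟨l, l.2, fun j i hi => ?_⟩⟩
  · exact (hle _ _ _).2 (hmx j i i.2)
  · exact (hle _ _ _).1 (hmx j ⟨i, hi⟩)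

lemma isLittleO_zpow_zpow_real {a b : ℤ} (hab : a < b) :
    (fun x : ℝ => x ^ a) =o[atTop] fun x => x ^ b := by
  refine (isLittleO_iff_tendsto' ?_).2 ?_
  · filter_upwards [eventually_gt_atTop 0] with x hx h0
    exact absurd h0 (zpow_ne_zero _ hx.ne')
  · refine (tendsto_zpow_atTop_zero (sub_neg.2 hab)).congr' ?_
    filter_upwards [eventually_gt_atTop 0] with x hx
    exact zpow_sub₀ hx.ne' a b

/-! ### Bounds and asymptotics of the sum in powers of `1 / m` -/

section Series

variable {q : ℕ → ℝ} {k : ℕ}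

lemma sum_mul_zpow_nonneg_le (hq : ∀ l, 0 ≤ q l) {m : ℕ} (hm : 1 ≤ m) :
    0 ≤ ∑ l ∈ Finset.Icc 2 k, q l * (m : ℝ) ^ (1 - (l : ℤ)) ∧
      ∑ l ∈ Finset.Icc 2 k, q l * (m : ℝ) ^ (1 - (l : ℤ)) ≤ (∑ l ∈ Finset.Icc 2 k, q l) / m := by
  have hm' : (1 : ℝ) ≤ m := by exact_mod_cast hm
  refine ⟨Finset.sum_nonneg fun l _ => mul_nonneg (hq l) (zpow_nonneg (by positivity) _), ?_⟩
  rw [Finset.sum_div]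
  refine Finset.sum_le_sum fun l hl => ?_
  rw [div_eq_mul_inv, ← zpow_neg_one]
  have : 2 ≤ l := (Finset.mem_Icc.1 hl).1
  exact mul_le_mul_of_nonneg_left (zpow_le_zpow_right₀ hm' (by omega)) (hq l)

lemma sum_mul_zpow_antitone (hq : ∀ l, 0 ≤ q l) {m n : ℕ} (hm : 1 ≤ m) (hmn : m ≤ n) :
    ∑ l ∈ Finset.Icc 2 k, q l * (n : ℝ) ^ (1 - (l : ℤ))
      ≤ ∑ l ∈ Finset.Icc 2 k, q l * (m : ℝ) ^ (1 - (l : ℤ)) := by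
  have hm' : (0 : ℝ) < m := by exact_mod_cast hm
  have hmn' : (m : ℝ) ≤ n := by exact_mod_cast hmn
  refine Finset.sum_le_sum fun l hl => mul_le_mul_of_nonneg_left ?_ (hq l)
  have h2 : 2 ≤ l := (Finset.mem_Icc.1 hl).1
  have h3 : (1 - (l : ℤ)) = -((l - 1 : ℕ) : ℤ) := by omega
  rw [h3, zpow_neg, zpow_neg, zpow_natCast, zpow_natCast]
  gcongr

/-- The least `L ≥ 2` with `q L > 0` gives the dominant term, whence `r = L - 1` and `c = q L`. -/
lemma sum_mul_zpow_isEquivalent (hq : ∀ l, 0 ≤ q l) (hpos : 0 < ∑ l ∈ Finset.Icc 2 k, q l) :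
    ∃ r : ℕ, 1 ≤ r ∧ r ≤ k - 1 ∧ ∃ c : ℝ, 0 < c ∧ c ≤ ∑ l ∈ Finset.Icc 2 k, q l ∧
      (fun m : ℕ => ∑ l ∈ Finset.Icc 2 k, q l * (m : ℝ) ^ (1 - (l : ℤ)))
        ~[atTop] (fun m : ℕ => c / (m : ℝ) ^ r) := by
  classical
  have hex : ∃ l, l ∈ Finset.Icc 2 k ∧ 0 < q l := by
    by_contra! hcon
    exact absurd (Finset.sum_nonpos fun l hl => hcon l hl) (not_le.2 hpos)
  set L := Nat.find hex with hL
  obtain ⟨hLmem, hLpos⟩ := Nat.find_spec hex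
  have hL2 := Finset.mem_Icc.1 hLmem
  refine ⟨L - 1, by omega, by omega, q L, hLpos,
    Finset.single_le_sum (fun l _ => hq l) hLmem, ?_⟩
  have hmain : (fun m : ℕ => q L * (m : ℝ) ^ (1 - (L : ℤ))) =ᶠ[atTop]
      fun m : ℕ => q L / (m : ℝ) ^ (L - 1) := Eventually.of_forall fun m => by
    have h3 : (1 - (L : ℤ)) = -((L - 1 : ℕ) : ℤ) := by omega
    simp only
    rw [h3, zpow_neg, zpow_natCast, div_eq_mul_inv]
  refine IsEquivalent.congr_right ?_ hmain
  have hsplit : (fun m : ℕ => ∑ l ∈ Finset.Icc 2 k, q l * (m : ℝ) ^ (1 - (l : ℤ)))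
      = (fun m : ℕ => q L * (m : ℝ) ^ (1 - (L : ℤ))) +
        fun m : ℕ => ∑ l ∈ (Finset.Icc 2 k).erase L, q l * (m : ℝ) ^ (1 - (l : ℤ)) := by
    ext m
    exact (Finset.add_sum_erase _ _ hLmem).symm
  rw [hsplit]
  refine IsEquivalent.add_isLittleO IsEquivalent.refl (IsLittleO.fun_sum fun l hl => ?_)
  obtain ⟨hlL, hl⟩ := Finset.mem_erase.1 hl
  rcases lt_or_gt_of_ne hlL with hlt | hgt
  · have h0 : q l = 0 := le_antisymm (not_lt.1 fun h => Nat.find_min hex hlt ⟨hl, h⟩) (hq l)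
    simp [h0]
  · refine IsLittleO.const_mul_left (IsLittleO.const_mul_right hLpos.ne' ?_) _
    exact (isLittleO_zpow_zpow_real (by omega)).comp_tendsto tendsto_natCast_atTop_atTop

end Series

end Concurrence

/-! ### Assembly -/

theorem mainTheorem5 {S Ω Ω' : Type*} [MeasurableSpace Ω] [MeasurableSpace Ω']
    (P : Measure Ω) [IsProbabilityMeasure P] (P' : Measure Ω') [IsProbabilityMeasure P']
    (X : ℕ → S → Ω → ℝ) (hX : Concurrence.IsIIDCopies X P)
    (ζ : ℕ → Ω' → ℝ) (Y : ℕ → S → Ω' → ℝ)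
    (hmax : Concurrence.IsMaxStable (X 0) P ζ Y P')
    (k : ℕ) (hk : 2 ≤ k) (s : Fin k → S)
    (p : ℝ) (hp : p = Concurrence.extremalConcurrenceProb ζ Y P' s)
    (pm : ℕ → ℝ) (hpm : ∀ m, pm m = Concurrence.sampleConcurrenceProb X P s m) :
    (∀ m : ℕ, 1 ≤ m →
      pm m = p + ∑ l ∈ Finset.Icc 2 k,
        P'.real {ω | Concurrence.numBlocks ζ Y s ω = l} * (m : ℝ) ^ (1 - (l : ℤ))) ∧
    (∀ m n : ℕ, 1 ≤ m → m ≤ n → pm n ≤ pm m) ∧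
    (∀ m : ℕ, 1 ≤ m → 0 ≤ pm m - p ∧ pm m - p ≤ (1 - p) / m) ∧
    (p < 1 → ∃ r : ℕ, 1 ≤ r ∧ r ≤ k - 1 ∧ ∃ c : ℝ, 0 < c ∧ c ≤ 1 - p ∧
      (fun m : ℕ => pm m - p) ~[atTop] (fun m : ℕ => c / (m : ℝ) ^ r)) := by
  have : NeZero k := ⟨by omega⟩
  have hspec := hmax.spectral.reindex s
  set q : ℕ → ℝ := fun l => P'.real {ω | Concurrence.numBlocks ζ Y s ω = l} with hqdef
  have hq : ∀ l, 0 ≤ q l := fun l => measureReal_nonneg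
  have hp1 : p = q 1 := hp.trans hspec.extremalConcurrenceProb_eq
  have hIcc : Finset.Icc 1 k = insert 1 (Finset.Icc 2 k) :=
    (Finset.insert_Icc_succ_left_eq_Icc (by omega)).symm
  have hsum : ∀ g : ℕ → ℝ, ∑ l ∈ Finset.Icc 1 k, g l = g 1 + ∑ l ∈ Finset.Icc 2 k, g l :=
    fun g => by rw [hIcc, Finset.sum_insert (by simp)]
  -- The block count lies almost surely in `{1, …, k}`, so its probabilities sum to one, and the
  -- term `l = 1` is `p`.
  have htot : ∑ l ∈ Finset.Icc 2 k, q l = 1 - p := by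
    have h1 := congrArg ENNReal.toReal (hspec.lintegral_numBlocks fun _ => 1)
    rw [ENNReal.toReal_sum fun l _ => by finiteness] at h1
    simp only [lintegral_one, measure_univ, ENNReal.toReal_one, one_mul] at h1
    have h2 : 1 = ∑ l ∈ Finset.Icc 1 k, q l := h1
    rw [hsum] at h2
    linarith
  have hform : ∀ m : ℕ, 1 ≤ m →
      pm m = p + ∑ l ∈ Finset.Icc 2 k, q l * (m : ℝ) ^ (1 - (l : ℤ)) := fun m hm => by
    have : NeZero m := ⟨by omega⟩
    have hm0 : (m : ℝ) ≠ 0 := by exact_mod_cast (by omega : m ≠ 0)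
    have hm0' : (m : ENNReal) ≠ 0 := by exact_mod_cast (by omega : m ≠ 0)
    rw [hpm, Concurrence.sampleConcurrenceProb_eq hX hmax s m, measureReal_def,
      hspec.pi_concurrenceSet m, ENNReal.toReal_sum fun l _ => by finiteness]
    have hterm : ∀ l, ((m : ENNReal) * ((m : ENNReal)⁻¹) ^ l
        * P' {ω | Concurrence.numBlocks ζ (fun i j => Y i (s j)) id ω = l}).toReal
        = q l * (m : ℝ) ^ (1 - (l : ℤ)) := fun l => by
      rw [zpow_sub₀ hm0, zpow_one, zpow_natCast, ENNReal.toReal_mul, ENNReal.toReal_mul,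
        ENNReal.toReal_pow, ENNReal.toReal_inv, ENNReal.toReal_natCast, inv_pow, mul_comm,
        div_eq_mul_inv]
      rfl
    rw [Finset.sum_congr rfl fun l _ => hterm l, hsum]
    simp [hp1]
  have hdiff : ∀ m : ℕ, 1 ≤ m →
      pm m - p = ∑ l ∈ Finset.Icc 2 k, q l * (m : ℝ) ^ (1 - (l : ℤ)) := fun m hm => by
    rw [hform m hm, add_sub_cancel_left]
  refine ⟨hform, fun m n hm hmn => ?_, fun m hm => ?_, fun hlt => ?_⟩
  · rw [hform m hm, hform n (hm.trans hmn)]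
    exact add_le_add_right (Concurrence.sum_mul_zpow_antitone hq hm hmn) p
  · rw [hdiff m hm, ← htot]
    exact Concurrence.sum_mul_zpow_nonneg_le hq hm
  · obtain ⟨r, hr1, hrk, c, hc, hcle, hequiv⟩ := Concurrence.sum_mul_zpow_isEquivalent hq
      (k := k) (by rw [htot]; linarith)
    refine ⟨r, hr1, hrk, c, hc, htot ▸ hcle, hequiv.congr_left ?_⟩
    filter_upwards [eventually_ge_atTop 1] with m hm
    exact (hdiff m hm).symm
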